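/- Let $\mathfrak g$ be a finite-dimensional real Lie algebra, $\mathfrak h\subset\mathfrak g$ a subalgebra, $H$ a Lie group whose Lie algebra is identified with $\mathfrak h$, and $\mathrm{ad}$ a smooth representation of $H$ on $\mathfrak g$ which restricts to the adjoint representation of $H$ on $\mathfrak h$. Let $\pi:P\to M$ be a smooth principal right $H$-bundle with $\dim M=\dim\mathfrak g-\dim\mathfrak h$. For $h\in H$ let $R_h:P\to P$ be the right translation, and for $\xi\in\mathfrak h$ let $\tilde\xi$ be the fundamental vector field on $P$. A Cartan geometry on $P$ modelled on $(\mathfrak g,\mathfrak h)$ with group $H$ is a smooth $\mathfrak g$-valued 1-form $\omega$ on $P$ such that (1) $\omega_p:T_pP\to\mathfrak g$ is a linear isomorphism for every $p\in P$; (2) $R_h^*\omega=\mathrm{ad}(h^{-1})\,\omega$ for every $h\in H$; (3) $\omega(\tilde\xi)=\xi$ for every $\xi\in\mathfrak h$. Let $TP/H\to M$ be the Atiyah bundle (the quotient of $TP$ by the action of $H$ through the differentials of the $R_h$), let $\overline{\mathfrak g}=P\times_H\mathfrak g\to M$ be the adjoint tractor bundle, associated with $P$ by $\mathrm{ad}$,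 and let $\overline{\mathfrak h}=P\times_H\mathfrak h$ be the adjoint bundle, associated with $P$ by the adjoint action of $H$ on $\mathfrak h$. The bundle $\overline{\mathfrak h}$ is regarded as a subbundle of $\overline{\mathfrak g}$ by $[p,\xi]\mapsto[p,\xi]$ and of $TP/H$ by $[p,\xi]\mapsto[\tilde\xi_p]$. Theorem. The vector bundles $TP/H$ and $\overline{\mathfrak g}$ have the same fibre dimension $\dim\mathfrak g$, and the Cartan geometries on $P$ modelled on $(\mathfrak g,\mathfrak h)$ with group $H$ are in one-to-one correspondence with the smooth vector bundle isomorphisms $TP/H\to\overline{\mathfrak g}$, over the identity of $M$, which reduce to the identity on $\overline{\mathfrak h}$. The correspondence takes $\omega$ to the isomorphism $\hat\omega$ given by $\hat\omega([v])=[p,\omega_p(v)]$ for $p\in P$ and $v\in T_pP$. -/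

import Mathlib

open Bundle Set
open scoped Manifold ContDiff Topology

/-! ### Lie algebras on normed spaces -/

/-- A Lie ring whose underlying additive group is a normed group.  Any finite-dimensional
real Lie algebra has such norms, all equivalent; the norm only serves to speak of smooth maps with
values in the Lie algebra. -/
class NormedLieRing (𝔤 : Type*) extends NormedAddCommGroup 𝔤, LieRing 𝔤

/-- A real Lie algebra whose underlying vector space is a normed space. -/
class NormedLieAlgebra (𝔤 : Type*) [NormedLieRing 𝔤] extends NormedSpace ℝ 𝔤, LieAlgebra ℝ 𝔤

instance minSmoothness_real_leInfty : ENat.LEInfty (minSmoothness ℝ 3) :=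
  ⟨by rw [minSmoothness_of_isRCLikeNormedField]; exact ENat.LEInfty.out⟩

noncomputable section

/-! ### Principal bundles -/

/-- A smooth principal right `H`-bundle `P → M`: a smooth right action of the Lie group `H` on `P`
and a projection which, over the members of an open cover of `M`, is equivariantly diffeomorphic to
the projection `U × H → U`. -/
structure PrincipalBundle (EH EP EM H P M : Type*)
    [NormedAddCommGroup EH] [NormedSpace ℝ EH] [NormedAddCommGroup EP] [NormedSpace ℝ EP]
    [NormedAddCommGroup EM] [NormedSpace ℝ EM]
    [TopologicalSpace H] [ChartedSpace EH H] [Group H]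
    [TopologicalSpace P] [ChartedSpace EP P] [TopologicalSpace M] [ChartedSpace EM M] where
  /-- the projection -/
  proj : P → M
  /-- the right action -/
  act : P → H → P
  act_one : ∀ p, act p 1 = p
  act_mul : ∀ p a b, act p (a * b) = act (act p a) b
  proj_act : ∀ p a, proj (act p a) = proj p
  smooth_act : ContMDiff (𝓘(ℝ, EP).prod 𝓘(ℝ, EH)) 𝓘(ℝ, EP) ∞ (fun q : P × H ↦ act q.1 q.2)
  locally_trivial : ∀ x : M, ∃ (U : Set M) (e : OpenPartialHomeomorph P (M × H)),
    IsOpen U ∧ x ∈ U ∧ e.source = proj ⁻¹' U ∧ e.target = U ×ˢ univ ∧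
    (∀ p ∈ e.source, (e p).1 = proj p) ∧
    (∀ p ∈ e.source, ∀ a, e (act p a) = ((e p).1, (e p).2 * a)) ∧
    ContMDiffOn 𝓘(ℝ, EP) (𝓘(ℝ, EM).prod 𝓘(ℝ, EH)) ∞ e e.source ∧
    ContMDiffOn (𝓘(ℝ, EM).prod 𝓘(ℝ, EH)) 𝓘(ℝ, EP) ∞ e.symm e.target

namespace PrincipalBundle

variable {EH EP EM H P M : Type*}
  [NormedAddCommGroup EH] [NormedSpace ℝ EH] [NormedAddCommGroup EP] [NormedSpace ℝ EP]
  [NormedAddCommGroup EM] [NormedSpace ℝ EM]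
  [TopologicalSpace H] [ChartedSpace EH H] [Group H]
  [TopologicalSpace P] [ChartedSpace EP P] [TopologicalSpace M] [ChartedSpace EM M]
  (B : PrincipalBundle EH EP EM H P M)

/-! #### The action is free, and transitive on the fibres -/

theorem exists_act_eq {p q : P} (h : B.proj p = B.proj q) : ∃ a, B.act p a = q := by
  obtain ⟨U, e, hU, hx, hs, ht, h1, h2, -, -⟩ := B.locally_trivial (B.proj p)
  have hp : p ∈ e.source := by rw [hs]; exact hx
  have hq : q ∈ e.source := by rw [hs, mem_preimage, ← h]; exact hx
  have ha (a : H) : B.act p a ∈ e.source := by rw [hs, mem_preimage, B.proj_act]; exact hx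
  refine ⟨(e p).2⁻¹ * (e q).2, e.injOn (ha _) hq ?_⟩
  rw [h2 p hp, mul_inv_cancel_left, h1 p hp, h, ← h1 q hq]

theorem act_injective (p : P) {a b : H} (h : B.act p a = B.act p b) : a = b := by
  obtain ⟨U, e, hU, hx, hs, ht, h1, h2, -, -⟩ := B.locally_trivial (B.proj p)
  have hp : p ∈ e.source := by rw [hs]; exact hx
  have := h2 p hp a
  rw [h, h2 p hp b] at this
  exact (mul_left_cancel (Prod.ext_iff.1 this).2).symm

theorem exists_proj_eq (x : M) : ∃ p, B.proj p = x := by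
  obtain ⟨U, e, hU, hx, hs, ht, h1, h2, -, -⟩ := B.locally_trivial x
  have hxt : (x, (1 : H)) ∈ e.target := by rw [ht]; exact ⟨hx, mem_univ _⟩
  refine ⟨e.symm (x, 1), ?_⟩
  rw [← h1 _ (e.map_target hxt), e.right_inv hxt]

open Classical in
/-- For `p` and `q` in the same fibre, the unique `a` with `q = p a`. -/
def div (p q : P) : H := if h : B.proj p = B.proj q then (B.exists_act_eq h).choose else 1

theorem act_div {p q : P} (h : B.proj p = B.proj q) : B.act p (B.div p q) = q := by
  rw [div, dif_pos h]
  exact (B.exists_act_eq h).choose_spec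

theorem contMDiff_proj : ContMDiff 𝓘(ℝ, EP) 𝓘(ℝ, EM) ∞ B.proj := by
  intro p
  obtain ⟨U, e, hU, hx, hs, ht, h1, h2, h3, -⟩ := B.locally_trivial (B.proj p)
  have hp : p ∈ e.source := by rw [hs]; exact hx
  have h4 : ContMDiffOn 𝓘(ℝ, EP) 𝓘(ℝ, EM) ∞ (fun q ↦ (e q).1) e.source :=
    contMDiff_fst.comp_contMDiffOn h3
  exact ((h4.congr fun q hq ↦ (h1 q hq).symm) p hp).contMDiffAt (e.open_source.mem_nhds hp)

/-- Smooth local sections of a principal bundle. -/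
structure LocalSection where
  /-- the domain -/
  U : Set M
  isOpen_U : IsOpen U
  /-- the section, extended by arbitrary values -/
  s : M → P
  smooth : ContMDiffOn 𝓘(ℝ, EM) 𝓘(ℝ, EP) ∞ s U
  proj_s : ∀ x ∈ U, B.proj (s x) = x

theorem exists_localSection (x : M) : ∃ σ : B.LocalSection, x ∈ σ.U := by
  obtain ⟨U, e, hU, hx, hs, ht, h1, h2, -, h4⟩ := B.locally_trivial x
  have hxt (y) (hy : y ∈ U) : (y, (1 : H)) ∈ e.target := by rw [ht]; exact ⟨hy, mem_univ _⟩
  refine ⟨⟨U, hU, fun y ↦ e.symm (y, 1), ?_, ?_⟩, hx⟩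
  · exact h4.comp (contMDiff_id.prodMk contMDiff_const).contMDiffOn hxt
  · intro y hy
    rw [← h1 _ (e.map_target (hxt y hy)), e.right_inv (hxt y hy)]

/-- The group-valued transition function between two local sections is smooth. -/
theorem contMDiffOn_div [LieGroup 𝓘(ℝ, EH) ∞ H] (σ τ : B.LocalSection) :
    ContMDiffOn 𝓘(ℝ, EM) 𝓘(ℝ, EH) ∞ (fun x ↦ B.div (σ.s x) (τ.s x)) (σ.U ∩ τ.U) := by
  rintro x ⟨hxσ, hxτ⟩
  obtain ⟨U, e, hU, hx, hs, ht, h1, h2, h3, -⟩ := B.locally_trivial x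
  have hσ : ∀ y ∈ σ.U ∩ τ.U ∩ U, σ.s y ∈ e.source := by
    rintro y ⟨⟨hy, -⟩, hyU⟩
    rw [hs, mem_preimage, σ.proj_s y hy]; exact hyU
  have hτ : ∀ y ∈ σ.U ∩ τ.U ∩ U, τ.s y ∈ e.source := by
    rintro y ⟨⟨-, hy⟩, hyU⟩
    rw [hs, mem_preimage, τ.proj_s y hy]; exact hyU
  have key : ContMDiffOn 𝓘(ℝ, EM) 𝓘(ℝ, EH) ∞
      (fun y ↦ (e (σ.s y)).2⁻¹ * (e (τ.s y)).2) (σ.U ∩ τ.U ∩ U) := by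
    have a1 := contMDiff_snd.comp_contMDiffOn
      (h3.comp (σ.smooth.mono fun y hy ↦ hy.1.1) hσ)
    have a2 := contMDiff_snd.comp_contMDiffOn
      (h3.comp (τ.smooth.mono fun y hy ↦ hy.1.2) hτ)
    exact a1.inv.mul a2
  have key2 : ContMDiffOn 𝓘(ℝ, EM) 𝓘(ℝ, EH) ∞
      (fun x ↦ B.div (σ.s x) (τ.s x)) (σ.U ∩ τ.U ∩ U) := by
    refine key.congr fun y hy ↦ ?_
    have hpr : B.proj (σ.s y) = B.proj (τ.s y) := by
      rw [σ.proj_s y hy.1.1, τ.proj_s y hy.1.2]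
    have := h2 _ (hσ y hy) (B.div (σ.s y) (τ.s y))
    rw [B.act_div hpr] at this
    rw [this, inv_mul_cancel_left]
  exact (key2 x ⟨⟨hxσ, hxτ⟩, hx⟩).mono_of_mem_nhdsWithin
    (Filter.inter_mem self_mem_nhdsWithin (mem_nhdsWithin_of_mem_nhds (hU.mem_nhds hx)))

/-! ### Equivariant vector bundles over `P` and their quotients by `H` -/

/-- A smooth right action of `H` on the total space of a vector bundle `V → P`, by fibrewise linear
maps, covering the action of `H` on `P`. -/
structure EquivariantBundle (F : Type*) [NormedAddCommGroup F] [NormedSpace ℝ F]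
    (V : P → Type*) [TopologicalSpace (TotalSpace F V)] [∀ p, AddCommGroup (V p)]
    [∀ p, Module ℝ (V p)] [∀ p, TopologicalSpace (V p)] [FiberBundle F V] where
  /-- the linear map from the fibre over `p` to the fibre over `p a` -/
  map : ∀ (p : P) (a : H), V p →ₗ[ℝ] V (B.act p a)
  map_one : ∀ p v, (⟨B.act p 1, map p 1 v⟩ : TotalSpace F V) = ⟨p, v⟩
  map_mul : ∀ p a b v, (⟨B.act p (a * b), map p (a * b) v⟩ : TotalSpace F V) =
    ⟨B.act (B.act p a) b, map (B.act p a) b (map p a v)⟩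
  smooth : ContMDiff ((𝓘(ℝ, EP).prod 𝓘(ℝ, F)).prod 𝓘(ℝ, EH)) (𝓘(ℝ, EP).prod 𝓘(ℝ, F)) ∞
    (fun q : TotalSpace F V × H ↦ (⟨B.act q.1.1 q.2, map q.1.1 q.2 q.1.2⟩ : TotalSpace F V))

namespace EquivariantBundle

variable {B}
variable {F : Type*} [NormedAddCommGroup F] [NormedSpace ℝ F]
  {V : P → Type*} [TopologicalSpace (TotalSpace F V)] [∀ p, AddCommGroup (V p)]
  [∀ p, Module ℝ (V p)] [∀ p, TopologicalSpace (V p)] [FiberBundle F V]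
  (E : B.EquivariantBundle F V)

/-- The right action on the total space. -/
def act (w : TotalSpace F V) (a : H) : TotalSpace F V := ⟨B.act w.1 a, E.map w.1 a w.2⟩

theorem act_one (w : TotalSpace F V) : E.act w 1 = w := E.map_one _ _

theorem act_mul (w : TotalSpace F V) (a b : H) : E.act w (a * b) = E.act (E.act w a) b :=
  E.map_mul _ _ _ _

/-- The orbit relation on the part of the total space that lies over `x`. -/
def fiberSetoid (x : M) : Setoid {w : TotalSpace F V // B.proj w.1 = x} where
  r w w' := ∃ a : H, E.act w.1 a = w'.1
  iseqv := by
    refine ⟨fun w ↦ ⟨1, E.act_one _⟩, ?_, ?_⟩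
    · rintro w w' ⟨a, h⟩
      exact ⟨a⁻¹, by rw [← h, ← E.act_mul, mul_inv_cancel, E.act_one]⟩
    · rintro w w' w'' ⟨a, h⟩ ⟨b, h'⟩
      exact ⟨a * b, by rw [E.act_mul, h, h']⟩

/-- The fibre over `x` of the quotient bundle `V / H → P / H = M`: the set of `H`-orbits in the
part of the total space of `V` that lies over `x`. -/
def Fiber (x : M) : Type _ := Quotient (E.fiberSetoid x)

/-- The class in `V / H` of a vector `v` at the point `p` over `x`. -/
def cls {x : M} (p : P) (hp : B.proj p = x) (v : V p) : E.Fiber x :=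
  Quotient.mk (E.fiberSetoid x) ⟨⟨p, v⟩, hp⟩

variable {E}

theorem cls_eq_cls {x : M} {p q : P} {hp : B.proj p = x} {hq : B.proj q = x} {v : V p} {w : V q} :
    E.cls p hp v = E.cls q hq w ↔ ∃ a, E.act ⟨p, v⟩ a = (⟨q, w⟩ : TotalSpace F V) := by
  unfold cls
  exact Quotient.eq (r := E.fiberSetoid x)

theorem cls_map {x : M} (p : P) (hp : B.proj p = x) (a : H) (v : V p) :
    E.cls (B.act p a) ((B.proj_act p a).trans hp) (E.map p a v) = E.cls p hp v :=
  (cls_eq_cls.2 ⟨a, rfl⟩).symm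

theorem cls_bijective {x : M} (p : P) (hp : B.proj p = x) :
    Function.Bijective (E.cls p hp) := by
  constructor
  · intro v w h
    obtain ⟨a, ha⟩ := cls_eq_cls.1 h
    have h1 : B.act p a = B.act p 1 := by
      rw [B.act_one]; exact congrArg TotalSpace.proj ha
    obtain rfl := B.act_injective p h1
    rw [E.act_one] at ha
    simpa using ha
  · intro z
    obtain ⟨⟨⟨q, w⟩, hq⟩, rfl⟩ := Quotient.exists_rep z
    obtain ⟨a, rfl⟩ := B.exists_act_eq (hq.trans hp.symm)
    exact ⟨E.map q a w, E.cls_map q hq a w⟩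

variable (E)

/-- A point of `P` over `x` identifies the fibre of `V` with the fibre of `V / H`. -/
def clsEquiv {x : M} (p : P) (hp : B.proj p = x) : V p ≃ E.Fiber x :=
  Equiv.ofBijective _ (cls_bijective p hp)

/-- The vector space structure on the fibres of `V / H`, transported from `V`; it does not depend
on the point used for this, see `clsₗ`. -/
instance instAddCommGroupFiber (x : M) : AddCommGroup (E.Fiber x) :=
  (E.clsEquiv _ (B.exists_proj_eq x).choose_spec).symm.addCommGroup

instance instModuleFiber (x : M) : Module ℝ (E.Fiber x) :=
  (E.clsEquiv _ (B.exists_proj_eq x).choose_spec).symm.module ℝ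

theorem exists_linearMap_cls {x : M} (p q : P) (hp : B.proj p = x) (hq : B.proj q = x) :
    ∃ T : V p →ₗ[ℝ] V q, ∀ v, E.cls q hq (T v) = E.cls p hp v := by
  obtain ⟨a, rfl⟩ := B.exists_act_eq (hp.trans hq.symm)
  exact ⟨E.map p a, fun v ↦ cls_map p hp a v⟩

/-- The class map at any point of `P` over `x` is a linear isomorphism. -/
def clsₗ {x : M} (p : P) (hp : B.proj p = x) : V p ≃ₗ[ℝ] E.Fiber x :=
  LinearEquiv.ofBijective
    { toFun := E.cls p hp
      map_add' := fun u v ↦ by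
        obtain ⟨T, hT⟩ := E.exists_linearMap_cls p _ hp (B.exists_proj_eq x).choose_spec
        rw [← hT, ← hT, ← hT, map_add]
        exact (((E.clsEquiv _ (B.exists_proj_eq x).choose_spec).symm.linearEquiv ℝ).symm.map_add
          (T u) (T v))
      map_smul' := fun c v ↦ by
        obtain ⟨T, hT⟩ := E.exists_linearMap_cls p _ hp (B.exists_proj_eq x).choose_spec
        rw [← hT, ← hT, map_smul]
        exact (((E.clsEquiv _ (B.exists_proj_eq x).choose_spec).symm.linearEquiv ℝ).symm.map_smul
          c (T v)) }
    (cls_bijective p hp)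

@[simp] theorem clsₗ_apply {x : M} (p : P) (hp : B.proj p = x) (v : V p) :
    E.clsₗ p hp v = E.cls p hp v := rfl

theorem clsₗ_symm_cls {x : M} (p q : P) (hp : B.proj p = x) (hq : B.proj q = x) (v : V p) :
    (⟨q, (E.clsₗ q hq).symm (E.cls p hp v)⟩ : TotalSpace F V) = E.act ⟨p, v⟩ (B.div p q) := by
  have h : E.cls p hp v = E.cls q hq ((E.clsₗ q hq).symm (E.cls p hp v)) :=
    ((E.clsₗ q hq).apply_symm_apply _).symm
  obtain ⟨a, ha⟩ := cls_eq_cls.1 h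
  have h1 : B.act p a = B.act p (B.div p q) := by
    rw [B.act_div (hp.trans hq.symm)]; exact congrArg TotalSpace.proj ha
  rw [← ha, B.act_injective p h1]

/-! #### The vector bundle structure of the quotient -/

section Pretrivialization

variable (σ : B.LocalSection) (t : Trivialization F (TotalSpace.proj : TotalSpace F V → P))

open Classical in
/-- A local section of `P` and a local trivialization of `V` define a local trivialization of the
quotient: represent a class over `x` by a vector at the value of the section at `x`, and take the
coordinates of that vector. -/
def pretriv : Pretrivialization F (TotalSpace.proj : TotalSpace F E.Fiber → M) where
  toFun z := (z.1, if h : B.proj (σ.s z.1) = z.1 then (t ⟨_, (E.clsₗ _ h).symm z.2⟩).2 else 0)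
  invFun z := ⟨z.1, if h : B.proj (σ.s z.1) = z.1 then E.clsₗ _ h (t.symm (σ.s z.1) z.2) else 0⟩
  baseSet := σ.U ∩ σ.s ⁻¹' t.baseSet
  source := TotalSpace.proj ⁻¹' (σ.U ∩ σ.s ⁻¹' t.baseSet)
  target := (σ.U ∩ σ.s ⁻¹' t.baseSet) ×ˢ univ
  map_source' := fun z hz ↦ ⟨hz, mem_univ _⟩
  map_target' := fun z hz ↦ hz.1
  left_inv' := by
    rintro ⟨x, z⟩ hz
    have h := σ.proj_s x hz.1
    simp only [dif_pos h]
    rw [t.symm_apply_apply_mk hz.2]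
    simp
  right_inv' := by
    rintro ⟨x, y⟩ hz
    have h := σ.proj_s x hz.1.1
    simp only [dif_pos h]
    rw [LinearEquiv.symm_apply_apply, t.apply_mk_symm hz.1.2]
  open_target := (σ.smooth.continuousOn.isOpen_inter_preimage σ.isOpen_U t.open_baseSet).prod
    isOpen_univ
  open_baseSet := σ.smooth.continuousOn.isOpen_inter_preimage σ.isOpen_U t.open_baseSet
  source_eq := rfl
  target_eq := rfl
  proj_toFun := fun z hz ↦ rfl

theorem pretriv_apply {x : M} (h : B.proj (σ.s x) = x) (z : E.Fiber x) :
    (E.pretriv σ t ⟨x, z⟩).2 = (t ⟨_, (E.clsₗ _ h).symm z⟩).2 :=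
  dif_pos h

theorem pretriv_symm_apply {x : M} (hx : x ∈ σ.U ∩ σ.s ⁻¹' t.baseSet) (y : F) :
    (E.pretriv σ t).symm x y = E.cls (σ.s x) (σ.proj_s x hx.1) (t.symm (σ.s x) y) := by
  have h1 : (⟨x, (E.pretriv σ t).symm x y⟩ : TotalSpace F E.Fiber) =
      ⟨x, E.clsₗ _ (σ.proj_s x hx.1) (t.symm (σ.s x) y)⟩ := by
    rw [(E.pretriv σ t).mk_symm hx]
    refine TotalSpace.ext rfl (heq_of_eq ?_)
    exact dif_pos (σ.proj_s x hx.1)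
  simpa using h1

theorem pretriv_isLinear [VectorBundle ℝ F V] [MemTrivializationAtlas t] :
    (E.pretriv σ t).IsLinear ℝ where
  linear x hx := by
    have h := σ.proj_s x hx.1
    have : t.IsLinear ℝ := inferInstance
    have h2 := (((t.linear ℝ hx.2).mk' _).comp (E.clsₗ _ h).symm.toLinearMap).isLinear
    convert h2 using 2 with z
    exact E.pretriv_apply σ t h z

/-- The coordinate changes between these local trivializations are smooth. -/
theorem exists_contMDiffOn_coordChange [LieGroup 𝓘(ℝ, EH) ∞ H] [VectorBundle ℝ F V]
    [FiniteDimensional ℝ F] [ContMDiffVectorBundle ∞ F V 𝓘(ℝ, EP)]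
    (τ : B.LocalSection) (t' : Trivialization F (TotalSpace.proj : TotalSpace F V → P))
    [MemTrivializationAtlas t] [MemTrivializationAtlas t'] :
    ∃ f : M → F →L[ℝ] F,
      ContMDiffOn 𝓘(ℝ, EM) 𝓘(ℝ, F →L[ℝ] F) ∞ f
        ((E.pretriv σ t).baseSet ∩ (E.pretriv τ t').baseSet) ∧
      ∀ x ∈ (E.pretriv σ t).baseSet ∩ (E.pretriv τ t').baseSet, ∀ y : F,
        f x y = (E.pretriv τ t' ⟨x, (E.pretriv σ t).symm x y⟩).2 := by
  have i1 := E.pretriv_isLinear σ t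
  have i2 := E.pretriv_isLinear τ t'
  let f : M → F →L[ℝ] F := fun x ↦ LinearMap.toContinuousLinearMap
    ((E.pretriv τ t').linearMapAt ℝ x ∘ₗ (E.pretriv σ t).symmₗ ℝ x)
  have hf : ∀ x ∈ (E.pretriv σ t).baseSet ∩ (E.pretriv τ t').baseSet, ∀ y : F,
        f x y = (E.pretriv τ t' ⟨x, (E.pretriv σ t).symm x y⟩).2 := by
    rintro x ⟨hx, hx'⟩ y
    simp only [f, LinearMap.coe_toContinuousLinearMap', LinearMap.comp_apply]
    rw [Pretrivialization.symmₗ_apply ℝ _ hx, Pretrivialization.coe_linearMapAt_of_mem _ hx']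
  refine ⟨f, ?_, hf⟩
  set S := (E.pretriv σ t).baseSet ∩ (E.pretriv τ t').baseSet with hS
  have hy (y : F) : ContMDiffOn 𝓘(ℝ, EM) 𝓘(ℝ, F) ∞ (fun x ↦ f x y) S := by
    have s1 : ContMDiffOn 𝓘(ℝ, EM) (𝓘(ℝ, EP).prod 𝓘(ℝ, F)) ∞
        (fun x ↦ t.toOpenPartialHomeomorph.symm (σ.s x, y)) S := by
      refine t.contMDiffOn_symm.comp (t := t.target)
        ((σ.smooth.mono fun x hx ↦ hx.1.1).prodMk contMDiffOn_const) fun x hx ↦ ?_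
      rw [mem_preimage, t.mem_target]
      exact hx.1.2
    have s2 : ContMDiffOn 𝓘(ℝ, EM) (𝓘(ℝ, EP).prod 𝓘(ℝ, F)) ∞
        (fun x ↦ E.act (t.toOpenPartialHomeomorph.symm (σ.s x, y))
          (B.div (σ.s x) (τ.s x))) S :=
      E.smooth.comp_contMDiffOn
        (s1.prodMk ((B.contMDiffOn_div σ τ).mono fun x hx ↦ ⟨hx.1.1, hx.2.1⟩))
    have eq1 : ∀ x ∈ S, E.act (t.toOpenPartialHomeomorph.symm (σ.s x, y))
        (B.div (σ.s x) (τ.s x)) =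
        E.act ⟨σ.s x, t.symm (σ.s x) y⟩ (B.div (σ.s x) (τ.s x)) := by
      intro x hx
      rw [t.mk_symm hx.1.2]
    have hdiv : ∀ x ∈ S, B.act (σ.s x) (B.div (σ.s x) (τ.s x)) = τ.s x := fun x hx ↦
      B.act_div ((σ.proj_s x hx.1.1).trans (τ.proj_s x hx.2.1).symm)
    have s3 := contMDiff_snd.comp_contMDiffOn <|
      (t'.contMDiffOn (n := ∞) (IB := 𝓘(ℝ, EP))).comp s2 fun x hx ↦ by
        rw [mem_preimage, eq1 x hx, t'.mem_source]
        change B.act (σ.s x) _ ∈ _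
        rw [hdiv x hx]
        exact hx.2.2
    refine s3.congr fun x hx ↦ ?_
    rw [hf x hx, E.pretriv_symm_apply σ t hx.1, E.pretriv_apply τ t' (τ.proj_s x hx.2.1),
      E.clsₗ_symm_cls, ← eq1 x hx]
    rfl
  -- a map into `F →L F` is smooth if its values at vectors are
  let e₁ := ContinuousLinearEquiv.ofFinrankEq (𝕜 := ℝ) (E := F)
    (F := Fin (Module.finrank ℝ F) → ℝ) (by simp)
  let e₂ := (e₁.arrowCongr (1 : F ≃L[ℝ] F)).trans
    (ContinuousLinearEquiv.piRing (Fin (Module.finrank ℝ F)))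
  have h2 : ContMDiffOn 𝓘(ℝ, EM) 𝓘(ℝ, Fin (Module.finrank ℝ F) → F) ∞ (fun x ↦ e₂ (f x)) S :=
    contMDiffOn_pi_space.2 fun i ↦ hy _
  refine (e₂.symm.contDiff.contMDiff.comp_contMDiffOn h2).congr fun x hx ↦ ?_
  exact (e₂.symm_apply_apply (f x)).symm

end Pretrivialization

/-- A choice of a local section of `P` near `x`. -/
def sectionAt (B : PrincipalBundle EH EP EM H P M) (x : M) : B.LocalSection :=
  (B.exists_localSection x).choose

theorem mem_sectionAt (x : M) : x ∈ (sectionAt B x).U := (B.exists_localSection x).choose_spec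

/-- The local trivialization of the quotient around `x` given by the choices above. -/
def pretrivAt (x : M) : Pretrivialization F (TotalSpace.proj : TotalSpace F E.Fiber → M) :=
  E.pretriv (sectionAt B x) (trivializationAt F V ((sectionAt B x).s x))

/-- The topology of the fibre as a finite-dimensional vector space. -/
instance instTopologicalSpaceFiber (x : M) : TopologicalSpace (E.Fiber x) :=
  TopologicalSpace.induced (E.pretrivAt x ∘ TotalSpace.mk x) inferInstance

variable [LieGroup 𝓘(ℝ, EH) ∞ H] [VectorBundle ℝ F V] [FiniteDimensional ℝ F]
  [ContMDiffVectorBundle ∞ F V 𝓘(ℝ, EP)]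

/-- The quotient as a vector bundle, through its local trivializations. -/
def prebundle : VectorPrebundle ℝ F E.Fiber where
  pretrivializationAtlas := {e | ∃ (σ : B.LocalSection)
    (t : Trivialization F (TotalSpace.proj : TotalSpace F V → P)),
    MemTrivializationAtlas t ∧ e = E.pretriv σ t}
  pretrivialization_linear' := by
    rintro _ ⟨σ, t, ht, rfl⟩
    exact E.pretriv_isLinear σ t
  pretrivializationAt := E.pretrivAt
  mem_base_pretrivializationAt x := ⟨mem_sectionAt x, mem_baseSet_trivializationAt F V _⟩
  pretrivialization_mem_atlas x := ⟨_, _, inferInstance, rfl⟩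
  exists_coordChange := by
    rintro _ ⟨σ, t, ht, rfl⟩ _ ⟨σ', t', ht', rfl⟩
    obtain ⟨f, hf, h⟩ := E.exists_contMDiffOn_coordChange σ t σ' t'
    exact ⟨f, hf.continuousOn, h⟩
  totalSpaceMk_isInducing x := ⟨rfl⟩

instance prebundle_isContMDiff : E.prebundle.IsContMDiff 𝓘(ℝ, EM) ∞ where
  exists_contMDiffCoordChange := by
    rintro _ ⟨σ, t, ht, rfl⟩ _ ⟨σ', t', ht', rfl⟩
    exact E.exists_contMDiffOn_coordChange σ t σ' t'

/-! The quotient `V / H` is a smooth vector bundle over `M`. -/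

instance instTopologicalSpaceTotalSpace : TopologicalSpace (TotalSpace F E.Fiber) :=
  E.prebundle.totalSpaceTopology

instance instFiberBundle : FiberBundle F E.Fiber := E.prebundle.toFiberBundle

instance instVectorBundle : VectorBundle ℝ F E.Fiber := E.prebundle.toVectorBundle

instance instContMDiffVectorBundle : ContMDiffVectorBundle ∞ F E.Fiber 𝓘(ℝ, EM) :=
  E.prebundle.contMDiffVectorBundle 𝓘(ℝ, EM)

end EquivariantBundle
end PrincipalBundle
/-! ### Smooth representations, tangent bundles and associated bundles -/

section PartialTangent

variable {EA EB EC A B C : Type*}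
  [NormedAddCommGroup EA] [NormedSpace ℝ EA] [NormedAddCommGroup EB] [NormedSpace ℝ EB]
  [NormedAddCommGroup EC] [NormedSpace ℝ EC]
  [TopologicalSpace A] [ChartedSpace EA A] [TopologicalSpace B] [ChartedSpace EB B]
  [TopologicalSpace C] [ChartedSpace EC C]

/-- The partial tangent map of a smooth function of two variables is smooth. -/
theorem contMDiff_partialTangentMap [IsManifold 𝓘(ℝ, EA) ∞ A] [IsManifold 𝓘(ℝ, EB) ∞ B]
    [IsManifold 𝓘(ℝ, EC) ∞ C] {f : B × A → C}
    (hf : ContMDiff (𝓘(ℝ, EB).prod 𝓘(ℝ, EA)) 𝓘(ℝ, EC) ∞ f) :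
    ContMDiff ((𝓘(ℝ, EB).prod 𝓘(ℝ, EB)).prod 𝓘(ℝ, EA)) (𝓘(ℝ, EC).prod 𝓘(ℝ, EC)) ∞
      (fun q : TangentBundle 𝓘(ℝ, EB) B × A ↦
        (⟨f (q.1.1, q.2), mfderiv 𝓘(ℝ, EB) 𝓘(ℝ, EC) (fun b ↦ f (b, q.2)) q.1.1 q.1.2⟩ :
          TangentBundle 𝓘(ℝ, EC) C)) := by
  have h1 := hf.contMDiff_tangentMap (m := ∞) le_rfl
  have h2 : ContMDiff ((𝓘(ℝ, EB).prod 𝓘(ℝ, EB)).prod 𝓘(ℝ, EA))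
      ((𝓘(ℝ, EB).prod 𝓘(ℝ, EA)).prod 𝓘(ℝ, EB × EA)) ∞
      (fun q : TangentBundle 𝓘(ℝ, EB) B × A ↦
        (equivTangentBundleProd 𝓘(ℝ, EB) B 𝓘(ℝ, EA) A).symm
          (q.1, zeroSection EA (TangentSpace 𝓘(ℝ, EA)) q.2)) :=
    contMDiff_equivTangentBundleProd_symm.comp
      (contMDiff_fst.prodMk ((contMDiff_zeroSection ℝ _).comp contMDiff_snd))
  refine (h1.comp h2).congr ?_
  rintro ⟨⟨b, v⟩, a⟩
  refine TotalSpace.ext rfl (heq_of_eq ?_)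
  have h3 : mfderiv 𝓘(ℝ, EB) 𝓘(ℝ, EC) (fun b ↦ f (b, a)) b =
      (mfderiv (𝓘(ℝ, EB).prod 𝓘(ℝ, EA)) 𝓘(ℝ, EC) f (b, a)).comp
        (mfderiv 𝓘(ℝ, EB) (𝓘(ℝ, EB).prod 𝓘(ℝ, EA)) (fun b ↦ (b, a)) b) :=
    mfderiv_comp (g := f) b (hf.mdifferentiableAt (by simp))
      ((contMDiff_id.prodMk contMDiff_const).mdifferentiableAt (n := ∞) (by simp))
  change mfderiv 𝓘(ℝ, EB) 𝓘(ℝ, EC) (fun b ↦ f (b, a)) b v = _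
  rw [h3, mfderiv_prod_left]
  rfl

end PartialTangent

/-- A smooth finite-dimensional real representation of a Lie group. -/
structure SmoothRep (EH H W : Type*) [NormedAddCommGroup EH] [NormedSpace ℝ EH]
    [TopologicalSpace H] [ChartedSpace EH H] [Group H]
    [NormedAddCommGroup W] [NormedSpace ℝ W] where
  /-- the representation -/
  rep : Representation ℝ H W
  smooth : ContMDiff (𝓘(ℝ, EH).prod 𝓘(ℝ, W)) 𝓘(ℝ, W) ∞ (fun q : H × W ↦ rep q.1 q.2)

section Adjoint

variable (EH H : Type*) [NormedAddCommGroup EH] [NormedSpace ℝ EH]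
  [TopologicalSpace H] [ChartedSpace EH H] [Group H]

/-- The adjoint action of `a` on the Lie algebra `T₁H` (which is the model space `EH` of `H`), that
is, the differential at `1` of the conjugation `b ↦ a b a⁻¹`. -/
def adjointMap (a : H) : EH →L[ℝ] EH :=
  mfderiv 𝓘(ℝ, EH) 𝓘(ℝ, EH) (fun b : H ↦ a * b * a⁻¹) 1

variable [LieGroup 𝓘(ℝ, EH) ∞ H]

variable {EH H} in
theorem contMDiff_conj : ContMDiff (𝓘(ℝ, EH).prod 𝓘(ℝ, EH)) 𝓘(ℝ, EH) ∞
    (fun q : H × H ↦ q.2 * q.1 * q.2⁻¹) :=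
  (contMDiff_snd.mul contMDiff_fst).mul contMDiff_snd.inv

variable {EH H} in
theorem mdifferentiableAt_conj (a b : H) :
    MDifferentiableAt 𝓘(ℝ, EH) 𝓘(ℝ, EH) (fun b : H ↦ a * b * a⁻¹) b :=
  (contMDiff_conj.comp (contMDiff_id.prodMk contMDiff_const)).mdifferentiableAt (n := ∞) (by simp)

theorem hasMFDerivAt_conj (a b : H) (hb : b = 1) :
    HasMFDerivAt 𝓘(ℝ, EH) 𝓘(ℝ, EH) (fun b : H ↦ a * b * a⁻¹) b (adjointMap EH H a) := by
  subst hb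
  exact (mdifferentiableAt_conj a 1).hasMFDerivAt

theorem adjointMap_one : adjointMap EH H 1 = ContinuousLinearMap.id ℝ EH := by
  have h : (fun b : H ↦ 1 * b * 1⁻¹) = id := by ext b; simp
  have h1 := hasMFDerivAt_conj EH H 1 1 rfl
  rw [h] at h1
  exact hasMFDerivAt_unique h1 (hasMFDerivAt_id 1)

theorem adjointMap_mul (a b : H) :
    adjointMap EH H (a * b) = (adjointMap EH H a).comp (adjointMap EH H b) := by
  have h : (fun c : H ↦ a * b * c * (a * b)⁻¹) =
      (fun c ↦ a * c * a⁻¹) ∘ fun c ↦ b * c * b⁻¹ := by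
    ext c; simp [mul_assoc]
  have h1 := hasMFDerivAt_conj EH H (a * b) 1 rfl
  rw [h] at h1
  exact hasMFDerivAt_unique h1
    ((hasMFDerivAt_conj EH H a (b * 1 * b⁻¹) (by simp)).comp (1 : H)
      (hasMFDerivAt_conj EH H b 1 rfl))

variable {EH H} in
theorem trivializationAt_one_snd (ξ : EH) :
    (trivializationAt EH (TangentSpace 𝓘(ℝ, EH)) (1 : H) ⟨1, ξ⟩).2 = ξ :=
  (tangentBundleCore 𝓘(ℝ, EH) H).coordChange_self (achart EH (1 : H)) 1
    (mem_achart_source EH (1 : H)) ξ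

theorem contMDiff_adjointMap : ContMDiff (𝓘(ℝ, EH).prod 𝓘(ℝ, EH)) 𝓘(ℝ, EH) ∞
    (fun q : H × EH ↦ adjointMap EH H q.1 q.2) := by
  have h0 : ContMDiff 𝓘(ℝ, EH) (𝓘(ℝ, EH).prod 𝓘(ℝ, EH)) ∞
      (fun ξ : EH ↦ (⟨1, ξ⟩ : TangentBundle 𝓘(ℝ, EH) H)) := by
    intro ξ₀
    rw [contMDiffAt_totalSpace]
    exact ⟨contMDiffAt_const, contMDiffAt_id.congr_of_eventuallyEq
      (Filter.Eventually.of_forall fun ξ ↦ trivializationAt_one_snd ξ)⟩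
  have h1 := (contMDiff_partialTangentMap (contMDiff_conj (EH := EH) (H := H))).comp
    ((h0.comp contMDiff_snd).prodMk contMDiff_fst : ContMDiff (𝓘(ℝ, EH).prod 𝓘(ℝ, EH)) _ ∞
      (fun q : H × EH ↦ ((⟨1, q.2⟩ : TangentBundle 𝓘(ℝ, EH) H), q.1)))
  have h2 : ContMDiff (𝓘(ℝ, EH).prod 𝓘(ℝ, EH)) (𝓘(ℝ, EH).prod 𝓘(ℝ, EH)) ∞
      (fun q : H × EH ↦ (⟨1, adjointMap EH H q.1 q.2⟩ : TangentBundle 𝓘(ℝ, EH) H)) := by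
    refine h1.congr fun q ↦ ?_
    have (x y : H) (h : x = y) (v : EH) :
      (⟨x, v⟩ : TangentBundle 𝓘(ℝ, EH) H) = ⟨y, v⟩ := by subst h; rfl
    exact this _ _ (by simp) _
  intro q₀
  have h3 := (contMDiffAt_totalSpace.1 (h2 q₀)).2
  exact h3.congr_of_eventuallyEq
    (Filter.Eventually.of_forall fun q ↦ (trivializationAt_one_snd _).symm)

/-- The adjoint representation of a Lie group on its Lie algebra. -/
def adjointRep : SmoothRep EH H EH where
  rep :=
    { toFun := fun a ↦ (adjointMap EH H a : EH →ₗ[ℝ] EH)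
      map_one' := by rw [adjointMap_one]; rfl
      map_mul' := fun a b ↦ by rw [adjointMap_mul]; rfl }
  smooth := contMDiff_adjointMap EH H

end Adjoint

namespace PrincipalBundle

variable {EH EP EM H P M : Type*}
  [NormedAddCommGroup EH] [NormedSpace ℝ EH] [NormedAddCommGroup EP] [NormedSpace ℝ EP]
  [NormedAddCommGroup EM] [NormedSpace ℝ EM]
  [TopologicalSpace H] [ChartedSpace EH H] [Group H]
  [TopologicalSpace P] [ChartedSpace EP P] [TopologicalSpace M] [ChartedSpace EM M]
  (B : PrincipalBundle EH EP EM H P M)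

/-- The product bundle `P × W` with the action `(p, w) a = (p a, a⁻¹ w)`.  Its quotient by `H` is
the vector bundle associated with `P` by the representation. -/
def associated [LieGroup 𝓘(ℝ, EH) ∞ H] {W : Type*} [NormedAddCommGroup W] [NormedSpace ℝ W]
    (ρ : SmoothRep EH H W) : B.EquivariantBundle W (Bundle.Trivial P W) where
  map _ a := ρ.rep a⁻¹
  map_one p v := by
    rw [B.act_one]
    refine TotalSpace.ext rfl (heq_of_eq ?_)
    change ρ.rep 1⁻¹ v = v
    simp
  map_mul p a b v := by
    rw [B.act_mul]
    refine TotalSpace.ext rfl (heq_of_eq ?_)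
    change ρ.rep (a * b)⁻¹ v = ρ.rep b⁻¹ (ρ.rep a⁻¹ v)
    simp
  smooth := by
    intro q₀
    rw [contMDiffAt_totalSpace]
    have h1 : ContMDiff ((𝓘(ℝ, EP).prod 𝓘(ℝ, W)).prod 𝓘(ℝ, EH)) 𝓘(ℝ, EP) ∞
        (fun q : TotalSpace W (Bundle.Trivial P W) × H ↦ B.act q.1.1 q.2) :=
      B.smooth_act.comp (((Bundle.contMDiff_proj (Bundle.Trivial P W)).comp contMDiff_fst).prodMk contMDiff_snd)
    have h2 : ContMDiff ((𝓘(ℝ, EP).prod 𝓘(ℝ, W)).prod 𝓘(ℝ, EH)) 𝓘(ℝ, W) ∞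
        (fun q : TotalSpace W (Bundle.Trivial P W) × H ↦ (q.1.2 : W)) := by
      intro q
      exact ((contMDiffAt_totalSpace (F := W) (E := Bundle.Trivial P W)).1
        (contMDiff_fst q)).2
    have h3 : ContMDiff ((𝓘(ℝ, EP).prod 𝓘(ℝ, W)).prod 𝓘(ℝ, EH)) 𝓘(ℝ, W) ∞
        (fun q : TotalSpace W (Bundle.Trivial P W) × H ↦ ρ.rep q.2⁻¹ (q.1.2 : W)) :=
      ρ.smooth.comp (contMDiff_snd.inv.prodMk h2)
    exact ⟨h1 q₀, h3 q₀⟩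

theorem mdifferentiableAt_act (a : H) (p : P) :
    MDifferentiableAt 𝓘(ℝ, EP) 𝓘(ℝ, EP) (fun q ↦ B.act q a) p :=
  (B.smooth_act.comp (contMDiff_id.prodMk contMDiff_const)).mdifferentiableAt (n := ∞) (by simp)

theorem mdifferentiableAt_orbit (p : P) (a : H) :
    MDifferentiableAt 𝓘(ℝ, EH) 𝓘(ℝ, EP) (fun b ↦ B.act p b) a :=
  (B.smooth_act.comp (contMDiff_const.prodMk contMDiff_id)).mdifferentiableAt (n := ∞) (by simp)

/-- The differential at `p` of the right translation by `a`. -/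
def dact (p : P) (a : H) : TangentSpace 𝓘(ℝ, EP) p →L[ℝ] TangentSpace 𝓘(ℝ, EP) (B.act p a) :=
  mfderiv 𝓘(ℝ, EP) 𝓘(ℝ, EP) (fun q ↦ B.act q a) p

/-- The tangent bundle `TP` with the action of `H` by the differentials of the right translations.
Its quotient `TP / H` is the Atiyah bundle. -/
def tangent [IsManifold 𝓘(ℝ, EP) ∞ P] [LieGroup 𝓘(ℝ, EH) ∞ H] :
    B.EquivariantBundle EP (fun p : P ↦ TangentSpace 𝓘(ℝ, EP) p) where
  map p a := B.dact p a
  map_one p v := by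
    have : (fun q ↦ B.act q 1) = id := funext B.act_one
    change tangentMap 𝓘(ℝ, EP) 𝓘(ℝ, EP) (fun q ↦ B.act q 1) ⟨p, v⟩ = _
    rw [this, tangentMap_id]
    rfl
  map_mul p a b v := by
    have : (fun q ↦ B.act q (a * b)) = (fun q ↦ B.act q b) ∘ fun q ↦ B.act q a :=
      funext fun q ↦ B.act_mul q a b
    change tangentMap 𝓘(ℝ, EP) 𝓘(ℝ, EP) (fun q ↦ B.act q (a * b)) ⟨p, v⟩ = _
    rw [this, tangentMap_comp (fun q ↦ B.mdifferentiableAt_act b q)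
      (fun q ↦ B.mdifferentiableAt_act a q)]
    rfl
  smooth := contMDiff_partialTangentMap B.smooth_act

theorem hasMFDerivAt_act (p q : P) (hq : q = p) (a : H) :
    HasMFDerivAt 𝓘(ℝ, EP) 𝓘(ℝ, EP) (fun q ↦ B.act q a) q (B.dact p a : EP →L[ℝ] EP) := by
  subst hq
  exact (B.mdifferentiableAt_act a q).hasMFDerivAt

/-- The differential at `1` of the orbit map `a ↦ p a`. -/
def dorbit (p : P) : EH →L[ℝ] EP := mfderiv 𝓘(ℝ, EH) 𝓘(ℝ, EP) (fun a : H ↦ B.act p a) 1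

theorem hasMFDerivAt_orbit (p : P) (a : H) (ha : a = 1) :
    HasMFDerivAt 𝓘(ℝ, EH) 𝓘(ℝ, EP) (fun b : H ↦ B.act p b) a (B.dorbit p) := by
  subst ha
  exact (B.mdifferentiableAt_orbit p 1).hasMFDerivAt

/-- The value at `p` of the fundamental vector field of `ξ ∈ T₁H`. -/
def fundamental (p : P) (ξ : EH) : TangentSpace 𝓘(ℝ, EP) p := B.dorbit p ξ

theorem fundamental_act [LieGroup 𝓘(ℝ, EH) ∞ H] (p : P) (a : H) (ξ : EH) :
    B.fundamental (B.act p a) (adjointMap EH H a⁻¹ ξ) = B.dact p a (B.fundamental p ξ) := by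
  have h : (fun b ↦ B.act (B.act p a) b) ∘ (fun b ↦ a⁻¹ * b * a⁻¹⁻¹) =
      (fun q ↦ B.act q a) ∘ fun b ↦ B.act p b := by
    ext b
    simp only [Function.comp_apply, ← B.act_mul]
    congr 1
    group
  have h1 := (B.hasMFDerivAt_orbit (B.act p a) (a⁻¹ * 1 * a⁻¹⁻¹) (by simp)).comp (1 : H)
    (hasMFDerivAt_conj EH H a⁻¹ 1 rfl)
  have h2 := (B.hasMFDerivAt_act p (B.act p 1) (B.act_one p) a).comp (1 : H)
    (B.hasMFDerivAt_orbit p 1 rfl)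
  rw [h] at h1
  exact congrArg (fun L : EH →L[ℝ] EP ↦ L ξ) (hasMFDerivAt_unique h1 h2)

namespace EquivariantBundle

variable {B}
variable {F F' : Type*} [NormedAddCommGroup F] [NormedSpace ℝ F]
  {V : P → Type*} [TopologicalSpace (TotalSpace F V)] [∀ p, AddCommGroup (V p)]
  [∀ p, Module ℝ (V p)] [∀ p, TopologicalSpace (V p)] [FiberBundle F V]
  [NormedAddCommGroup F'] [NormedSpace ℝ F']
  {V' : P → Type*} [TopologicalSpace (TotalSpace F' V')] [∀ p, AddCommGroup (V' p)]
  [∀ p, Module ℝ (V' p)] [∀ p, TopologicalSpace (V' p)] [FiberBundle F' V']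

/-- An equivariant map over `P` induces a map of the quotients. -/
def fiberMap (E : B.EquivariantBundle F V) (E' : B.EquivariantBundle F' V')
    (φ : ∀ p, V p → V' p) (hφ : ∀ p a v, φ (B.act p a) (E.map p a v) = E'.map p a (φ p v))
    (x : M) : E.Fiber x → E'.Fiber x :=
  Quotient.map (sa := E.fiberSetoid x) (sb := E'.fiberSetoid x)
    (fun w ↦ ⟨⟨w.1.1, φ w.1.1 w.1.2⟩, w.2⟩) (by
      rintro ⟨⟨p, v⟩, hp⟩ ⟨⟨q, w⟩, hq⟩ ⟨a, ha⟩
      have ha' : E.act ⟨p, v⟩ a = (⟨q, w⟩ : TotalSpace F V) := ha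
      refine ⟨a, ?_⟩
      change (⟨B.act p a, E'.map p a (φ p v)⟩ : TotalSpace F' V') = ⟨q, φ q w⟩
      rw [← hφ]
      exact congrArg (fun u : TotalSpace F V ↦ (⟨u.1, φ u.1 u.2⟩ : TotalSpace F' V')) ha')

end EquivariantBundle

end PrincipalBundle

/-! ### Cartan geometries -/

/-- The model data of a Cartan geometry: a Lie subalgebra `𝔥` of `𝔤`, an identification of `𝔥` with
the Lie algebra of `H`, and a representation of `H` on `𝔤` which restricts to the adjoint
representation of `H` on `𝔥`. -/
structure CartanModel (EH H 𝔤 : Type*) [NormedAddCommGroup EH] [NormedSpace ℝ EH] [CompleteSpace EH]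
    [TopologicalSpace H] [ChartedSpace EH H] [Group H] [LieGroup 𝓘(ℝ, EH) ∞ H]
    [NormedLieRing 𝔤] [NormedLieAlgebra 𝔤] where
  /-- the subalgebra -/
  𝔥 : LieSubalgebra ℝ 𝔤
  /-- the identification of the Lie algebra of `H` with `𝔥` -/
  iso : GroupLieAlgebra 𝓘(ℝ, EH) H ≃ₗ⁅ℝ⁆ 𝔥
  /-- the representation of `H` on `𝔤` -/
  ad : SmoothRep EH H 𝔤
  ad_iso : ∀ (a : H) (ξ : GroupLieAlgebra 𝓘(ℝ, EH) H),
    ad.rep a (iso ξ : 𝔤) = (iso (adjointMap EH H a ξ) : 𝔤)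

/-- An isomorphism of smooth vector bundles over the identity of the base `M`: a family of linear
isomorphisms of the fibres such that the induced map of the total spaces and its inverse are
smooth. -/
structure VectorBundleIso {EM M : Type*} [NormedAddCommGroup EM] [NormedSpace ℝ EM]
    [TopologicalSpace M] [ChartedSpace EM M]
    (F₁ : Type*) [NormedAddCommGroup F₁] [NormedSpace ℝ F₁]
    (E₁ : M → Type*) [TopologicalSpace (TotalSpace F₁ E₁)] [∀ x, AddCommGroup (E₁ x)]
    [∀ x, Module ℝ (E₁ x)] [∀ x, TopologicalSpace (E₁ x)] [FiberBundle F₁ E₁]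
    (F₂ : Type*) [NormedAddCommGroup F₂] [NormedSpace ℝ F₂]
    (E₂ : M → Type*) [TopologicalSpace (TotalSpace F₂ E₂)] [∀ x, AddCommGroup (E₂ x)]
    [∀ x, Module ℝ (E₂ x)] [∀ x, TopologicalSpace (E₂ x)] [FiberBundle F₂ E₂] where
  /-- the isomorphisms of the fibres -/
  equiv : ∀ x, E₁ x ≃ₗ[ℝ] E₂ x
  smooth : ContMDiff (𝓘(ℝ, EM).prod 𝓘(ℝ, F₁)) (𝓘(ℝ, EM).prod 𝓘(ℝ, F₂)) ∞
    (fun z : TotalSpace F₁ E₁ ↦ (⟨z.1, equiv z.1 z.2⟩ : TotalSpace F₂ E₂))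
  smooth_symm : ContMDiff (𝓘(ℝ, EM).prod 𝓘(ℝ, F₂)) (𝓘(ℝ, EM).prod 𝓘(ℝ, F₁)) ∞
    (fun z : TotalSpace F₂ E₂ ↦ (⟨z.1, (equiv z.1).symm z.2⟩ : TotalSpace F₁ E₁))

namespace PrincipalBundle

variable {EH EP EM H P M 𝔤 : Type*}
  [NormedAddCommGroup EH] [NormedSpace ℝ EH] [FiniteDimensional ℝ EH] [CompleteSpace EH]
  [NormedAddCommGroup EP] [NormedSpace ℝ EP] [FiniteDimensional ℝ EP]
  [NormedAddCommGroup EM] [NormedSpace ℝ EM]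
  [TopologicalSpace H] [ChartedSpace EH H] [Group H] [LieGroup 𝓘(ℝ, EH) ∞ H]
  [TopologicalSpace P] [ChartedSpace EP P] [IsManifold 𝓘(ℝ, EP) ∞ P]
  [TopologicalSpace M] [ChartedSpace EM M]
  [NormedLieRing 𝔤] [NormedLieAlgebra 𝔤] [FiniteDimensional ℝ 𝔤]
  (B : PrincipalBundle EH EP EM H P M) (m : CartanModel EH H 𝔤)

/-- The Atiyah bundle `TP / H` of a principal bundle `P → M`, by its fibres over `M`. -/
abbrev Atiyah : M → Type _ := B.tangent.Fiber

/-- The adjoint tractor bundle `P ×_H 𝔤`, by its fibres over `M`. -/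
abbrev Tractor : M → Type _ := (B.associated m.ad).Fiber

/-- The adjoint bundle `P ×_H 𝔥`, for the adjoint action of `H` on its Lie algebra, by its fibres
over `M`. -/
abbrev Adjoint : M → Type _ := (B.associated (adjointRep EH H)).Fiber

/-- The adjoint bundle as a subbundle of the adjoint tractor bundle: `[p, ξ] ↦ [p, ξ]`. -/
def adjointToTractor (x : M) : B.Adjoint x → B.Tractor m x :=
  EquivariantBundle.fiberMap _ _ (fun _ (ξ : EH) ↦ (m.iso (ξ : GroupLieAlgebra 𝓘(ℝ, EH) H) : 𝔤))
    (fun _ a ξ ↦ (m.ad_iso a⁻¹ ξ).symm) x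

/-- The adjoint bundle as a subbundle of the Atiyah bundle: `[p, ξ]` is mapped to the class of the
value at `p` of the fundamental vector field of `ξ`. -/
def adjointToAtiyah (x : M) : B.Adjoint x → B.Atiyah x :=
  EquivariantBundle.fiberMap _ _ (fun p (ξ : EH) ↦ B.fundamental p ξ)
    (fun p a ξ ↦ B.fundamental_act p a ξ) x

/-- A Cartan geometry on the principal bundle `P`, that is, a Cartan connection form on `P`. -/
structure CartanGeometry where
  /-- the `𝔤`-valued 1-form on `P` -/
  form : ∀ p : P, TangentSpace 𝓘(ℝ, EP) p →ₗ[ℝ] 𝔤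
  smooth : ContMDiff (𝓘(ℝ, EP).prod 𝓘(ℝ, EP)) 𝓘(ℝ, 𝔤) ∞
    (fun w : TangentBundle 𝓘(ℝ, EP) P ↦ form w.1 w.2)
  bijective : ∀ p, Function.Bijective (form p)
  equivariant : ∀ p a v, form (B.act p a) (B.dact p a v) = m.ad.rep a⁻¹ (form p v)
  form_fundamental : ∀ p (ξ : GroupLieAlgebra 𝓘(ℝ, EH) H),
    form p (B.fundamental p ξ) = (m.iso ξ : 𝔤)

/-- The isomorphisms of vector bundles from the Atiyah bundle to the adjoint tractor bundle, over
the identity of `M`, that reduce to the identity on the common subbundle `P ×_H 𝔥`. -/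
structure AtiyahTractorIso extends
    VectorBundleIso (EM := EM) EP B.Atiyah 𝔤 (B.Tractor m) where
  reduces_to_id : ∀ x (s : B.Adjoint x), equiv x (B.adjointToAtiyah x s) = B.adjointToTractor m x s

end PrincipalBundle

end

/-! A point `p` over `x` identifies `T_pP` with the fibre of `TP/H` by `v ↦ [v]`, and `𝔤` with the
tractor fibre by `ξ ↦ [p, ξ]`. Read through these two identifications, a linear isomorphism of the
fibres over `x` is a linear isomorphism `ω_p : T_pP → 𝔤` for each `p` over `x`. That the `ω_p` all
come from one map of the fibres is exactly the equivariance of `ω`, and reduction to the identity on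
`P ×_H 𝔥` is exactly `ω(ξ̃) = ξ`.

What remains is smoothness. For any equivariant bundle `V → P` the quotient map `V → V/H` is smooth
(`contMDiff_mkTotal`) and has smooth local lifts over local sections of `P` (`contMDiffAt_lift`).
Hence a smooth map upstairs descends to a smooth map (`contMDiff_of_mkTotal`). Conversely, a map
covering a smooth map of quotients is smooth (`contMDiff_of_mkTotal_comp`): it is a local lift,
translated by an element of `H` that depends smoothly on the base points
(`contMDiffOn_div_fiberProduct`). Smoothness of the inverse isomorphism is smoothness of inversion
of linear maps (`contMDiff_bundleEquiv_symm`).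

The fibre dimensions agree because `dim P = dim M + dim H`. -/

namespace PrincipalBundle

/-! ### Smooth maps into, out of and between quotient bundles `V/H`. -/

section Quotient

variable {EH EP EM H P M : Type*}
  [NormedAddCommGroup EH] [NormedSpace ℝ EH] [NormedAddCommGroup EP] [NormedSpace ℝ EP]
  [NormedAddCommGroup EM] [NormedSpace ℝ EM]
  [TopologicalSpace H] [ChartedSpace EH H] [Group H]
  [TopologicalSpace P] [ChartedSpace EP P] [TopologicalSpace M] [ChartedSpace EM M]
  (B : PrincipalBundle EH EP EM H P M)

/-- The division map of a principal bundle is smooth on the fibre product `P ×_M P`. -/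
theorem contMDiffOn_div_fiberProduct [LieGroup 𝓘(ℝ, EH) ∞ H] :
    ContMDiffOn (𝓘(ℝ, EP).prod 𝓘(ℝ, EP)) 𝓘(ℝ, EH) ∞ (fun q : P × P ↦ B.div q.1 q.2)
      {q | B.proj q.1 = B.proj q.2} := by
  rintro ⟨p₀, q₀⟩ h₀
  obtain ⟨U, e, hU, hx, hs, ht, h1, h2, h3, -⟩ := B.locally_trivial (B.proj p₀)
  have hopen : IsOpen (Prod.fst ⁻¹' e.source : Set (P × P)) := e.open_source.preimage continuous_fst
  have hp₀ : (p₀, q₀) ∈ (Prod.fst ⁻¹' e.source : Set (P × P)) := by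
    change p₀ ∈ e.source
    rw [hs]; exact hx
  have hq (q : P × P) (hq : q ∈ {q : P × P | B.proj q.1 = B.proj q.2} ∩ Prod.fst ⁻¹' e.source) :
      q.2 ∈ e.source := by
    obtain ⟨ha, hb⟩ := hq
    rw [mem_preimage, hs, mem_preimage] at hb
    rw [hs, mem_preimage, ← show B.proj q.1 = B.proj q.2 from ha]
    exact hb
  -- In a trivialization, two points of one fibre differ only in their group coordinates `g`, `g'`,
  -- and by equivariance the element carrying one to the other is `g⁻¹ g'`.
  have key : ContMDiffOn (𝓘(ℝ, EP).prod 𝓘(ℝ, EP)) 𝓘(ℝ, EH) ∞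
      (fun q : P × P ↦ (e q.1).2⁻¹ * (e q.2).2)
      ({q | B.proj q.1 = B.proj q.2} ∩ Prod.fst ⁻¹' e.source) := by
    have a1 := contMDiff_snd.comp_contMDiffOn
      (h3.comp (contMDiff_fst (I := 𝓘(ℝ, EP)) (J := 𝓘(ℝ, EP))
        (M := P) (N := P)).contMDiffOn (s := {q : P × P | B.proj q.1 = B.proj q.2} ∩ Prod.fst ⁻¹' e.source)
        fun q hq ↦ hq.2)
    have a2 := contMDiff_snd.comp_contMDiffOn
      (h3.comp (contMDiff_snd (I := 𝓘(ℝ, EP)) (J := 𝓘(ℝ, EP))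
        (M := P) (N := P)).contMDiffOn (s := {q : P × P | B.proj q.1 = B.proj q.2} ∩ Prod.fst ⁻¹' e.source)
        fun q hq' ↦ hq q hq')
    exact a1.inv.mul a2
  have key2 := key.congr (f₁ := fun q : P × P ↦ B.div q.1 q.2) fun q hq' ↦ by
    have := h2 q.1 hq'.2 (B.div q.1 q.2)
    rw [B.act_div hq'.1] at this
    rw [this, inv_mul_cancel_left]
  exact (key2 _ ⟨h₀, hp₀⟩).mono_of_mem_nhdsWithin
    (Filter.inter_mem self_mem_nhdsWithin (mem_nhdsWithin_of_mem_nhds (hopen.mem_nhds hp₀)))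

namespace EquivariantBundle

variable {B}
variable {F : Type*} [NormedAddCommGroup F] [NormedSpace ℝ F]
  {V : P → Type*} [TopologicalSpace (TotalSpace F V)] [∀ p, AddCommGroup (V p)]
  [∀ p, Module ℝ (V p)] [∀ p, TopologicalSpace (V p)] [FiberBundle F V]
  (E : B.EquivariantBundle F V)

/-- The quotient map of the total spaces `V → V / H`. -/
def mkTotal (w : TotalSpace F V) : TotalSpace F E.Fiber := ⟨B.proj w.1, E.cls w.1 rfl w.2⟩

theorem mk_cls_eq_mkTotal {x : M} (p : P) (hp : B.proj p = x) (v : V p) :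
    (⟨x, E.cls p hp v⟩ : TotalSpace F E.Fiber) = E.mkTotal ⟨p, v⟩ := by
  subst hp; rfl

-- The action on `P` is free, so the element relating two representatives of a class is determined
-- by their base points. This recovers a vector from its class, its base point and any other
-- representative.
variable {E} in
theorem act_div_of_mkTotal_eq {w w' : TotalSpace F V} (h : E.mkTotal w = E.mkTotal w') :
    E.act w (B.div w.1 w'.1) = w' := by
  obtain ⟨p, v⟩ := w
  obtain ⟨q, u⟩ := w'
  have hpq : B.proj p = B.proj q := congrArg TotalSpace.proj h
  have h2 : E.cls p hpq v = E.cls q rfl u := by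
    have := (E.mk_cls_eq_mkTotal p hpq v).trans h
    simpa [mkTotal] using this
  rw [← E.clsₗ_symm_cls p q hpq rfl v, h2]
  congr 1
  exact (E.clsₗ q rfl).symm_apply_apply u

open Classical in
/-- Represent classes in `V / H` by vectors over the values of a local section of `P`. -/
noncomputable def lift (σ : B.LocalSection) (z : TotalSpace F E.Fiber) : TotalSpace F V :=
  -- The value `0` never occurs over `σ.U`, where the section property holds.
  ⟨σ.s z.1, if h : B.proj (σ.s z.1) = z.1 then (E.clsₗ _ h).symm z.2 else 0⟩

theorem mkTotal_lift {σ : B.LocalSection} {z : TotalSpace F E.Fiber} (hz : z.1 ∈ σ.U) :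
    E.mkTotal (E.lift σ z) = z := by
  have h := σ.proj_s _ hz
  rw [lift, dif_pos h, ← E.mk_cls_eq_mkTotal _ h]
  congr 1
  exact (E.clsₗ _ h).apply_symm_apply z.2

variable [LieGroup 𝓘(ℝ, EH) ∞ H]
  [VectorBundle ℝ F V] [FiniteDimensional ℝ F] [ContMDiffVectorBundle ∞ F V 𝓘(ℝ, EP)]

/-- Holds by the construction of the bundle charts of `V/H`. It turns smoothness into or out of
`V/H` into a question about trivializations of `V`. -/
theorem trivializationAt_snd {x₀ x : M} (h : B.proj ((sectionAt B x₀).s x) = x) (z : E.Fiber x) :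
    (trivializationAt F E.Fiber x₀ ⟨x, z⟩).2 =
      (trivializationAt F V ((sectionAt B x₀).s x₀) ⟨_, (E.clsₗ _ h).symm z⟩).2 :=
  E.pretriv_apply _ _ h z

/-- The quotient map `V → V / H` is smooth. -/
theorem contMDiff_mkTotal :
    ContMDiff (𝓘(ℝ, EP).prod 𝓘(ℝ, F)) (𝓘(ℝ, EM).prod 𝓘(ℝ, F)) ∞ E.mkTotal := by
  intro w₀
  rw [contMDiffAt_totalSpace]
  have hproj : ContMDiff (𝓘(ℝ, EP).prod 𝓘(ℝ, F)) 𝓘(ℝ, EM) ∞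
      (fun w : TotalSpace F V ↦ B.proj w.1) := B.contMDiff_proj.comp (Bundle.contMDiff_proj V)
  refine ⟨hproj w₀, ?_⟩
  set x₀ := B.proj w₀.1 with hx₀
  set σ := sectionAt B x₀ with hσ
  have hmem : x₀ ∈ σ.U := mem_sectionAt x₀
  have hs : ContMDiffAt (𝓘(ℝ, EP).prod 𝓘(ℝ, F)) 𝓘(ℝ, EP) ∞
      (fun w : TotalSpace F V ↦ σ.s (B.proj w.1)) w₀ :=
    ContMDiffAt.comp w₀ (g := σ.s) (σ.smooth.contMDiffAt (σ.isOpen_U.mem_nhds hmem)) (hproj w₀)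
  have hU : ∀ᶠ w : TotalSpace F V in 𝓝 w₀, B.proj w.1 ∈ σ.U :=
    (hproj w₀).continuousAt.eventually (σ.isOpen_U.mem_nhds hmem)
  -- The representative of `[w]` over the section is `w` moved by this element of `H`. The division
  -- map is smooth only on the fibre product, hence the detour through smoothness within a set,
  -- which is then seen to be a neighbourhood.
  have hdiv : ContMDiffAt (𝓘(ℝ, EP).prod 𝓘(ℝ, F)) 𝓘(ℝ, EH) ∞
      (fun w : TotalSpace F V ↦ B.div w.1 (σ.s (B.proj w.1))) w₀ := by
    have h1 : ContMDiffWithinAt (𝓘(ℝ, EP).prod 𝓘(ℝ, F)) 𝓘(ℝ, EH) ∞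
      (fun w : TotalSpace F V ↦ B.div w.1 (σ.s (B.proj w.1))) {w | B.proj w.1 ∈ σ.U} w₀ :=
      ContMDiffWithinAt.comp w₀ (g := fun q : P × P ↦ B.div q.1 q.2)
        (f := fun w : TotalSpace F V ↦ (w.1, σ.s (B.proj w.1)))
        (B.contMDiffOn_div_fiberProduct _ (σ.proj_s _ hmem).symm)
        (((Bundle.contMDiff_proj V) w₀).prodMk hs).contMDiffWithinAt
        (fun w hw ↦ (σ.proj_s _ hw).symm)
    exact h1.contMDiffAt hU
  have hact : ContMDiffAt (𝓘(ℝ, EP).prod 𝓘(ℝ, F)) (𝓘(ℝ, EP).prod 𝓘(ℝ, F)) ∞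
      (fun w : TotalSpace F V ↦ E.act w (B.div w.1 (σ.s (B.proj w.1)))) w₀ :=
    ContMDiffAt.comp w₀ (E.smooth (w₀, _)) (contMDiffAt_id.prodMk hdiv)
  -- Ensures that the trivialization of `V` in which `hact` is read is the one at `σ.s x₀`, as in
  -- `trivializationAt_snd`.
  have hbase : (E.act w₀ (B.div w₀.1 (σ.s (B.proj w₀.1)))).1 = σ.s x₀ :=
    B.act_div (σ.proj_s _ hmem).symm
  rw [contMDiffAt_totalSpace, hbase] at hact
  refine hact.2.congr_of_eventuallyEq (hU.mono fun w hw ↦ ?_)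
  refine (E.trivializationAt_snd (σ.proj_s _ hw) (E.cls w.1 rfl w.2)).trans ?_
  rw [E.clsₗ_symm_cls]

/-- In the distinguished trivializations the lift is the section on the base and the identity on the
fibre coordinate. -/
theorem contMDiffAt_lift (z₀ : TotalSpace F E.Fiber) :
    ContMDiffAt (𝓘(ℝ, EM).prod 𝓘(ℝ, F)) (𝓘(ℝ, EP).prod 𝓘(ℝ, F)) ∞
      (E.lift (sectionAt B z₀.1)) z₀ := by
  rw [contMDiffAt_totalSpace]
  set σ := sectionAt B z₀.1 with hσ
  have hmem : z₀.1 ∈ σ.U := mem_sectionAt z₀.1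
  have hproj : ContMDiffAt (𝓘(ℝ, EM).prod 𝓘(ℝ, F)) 𝓘(ℝ, EM) ∞
      (fun z : TotalSpace F E.Fiber ↦ z.1) z₀ := contMDiffAt_proj E.Fiber
  refine ⟨ContMDiffAt.comp z₀ (g := σ.s) (σ.smooth.contMDiffAt (σ.isOpen_U.mem_nhds hmem)) hproj,
    ?_⟩
  have h1 := (contMDiffAt_totalSpace.1 (contMDiffAt_id (I := 𝓘(ℝ, EM).prod 𝓘(ℝ, F))
    (n := ∞) (x := z₀))).2
  refine h1.congr_of_eventuallyEq
    ((hproj.continuousAt.eventually (σ.isOpen_U.mem_nhds hmem)).mono fun z hz ↦ ?_)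
  have h := σ.proj_s _ hz
  refine Eq.trans ?_ (E.trivializationAt_snd h z.2).symm
  simp only [lift, dif_pos h]
  rfl

variable {E}
variable {F' : Type*} [NormedAddCommGroup F'] [NormedSpace ℝ F']
  {V' : P → Type*} [TopologicalSpace (TotalSpace F' V')] [∀ p, AddCommGroup (V' p)]
  [∀ p, Module ℝ (V' p)] [∀ p, TopologicalSpace (V' p)] [FiberBundle F' V']
  [VectorBundle ℝ F' V'] [FiniteDimensional ℝ F'] [ContMDiffVectorBundle ∞ F' V' 𝓘(ℝ, EP)]
  {E' : B.EquivariantBundle F' V'}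

/-- A map out of a quotient bundle is smooth if it is covered by a smooth map. -/
theorem contMDiff_of_mkTotal {Ψ : TotalSpace F E.Fiber → TotalSpace F' E'.Fiber}
    {φ : TotalSpace F V → TotalSpace F' V'}
    (hφ : ContMDiff (𝓘(ℝ, EP).prod 𝓘(ℝ, F)) (𝓘(ℝ, EP).prod 𝓘(ℝ, F')) ∞ φ)
    (h : ∀ w, Ψ (E.mkTotal w) = E'.mkTotal (φ w)) :
    ContMDiff (𝓘(ℝ, EM).prod 𝓘(ℝ, F)) (𝓘(ℝ, EM).prod 𝓘(ℝ, F')) ∞ Ψ := by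
  intro z₀
  -- Near `z₀`, `Ψ` is the composite of local lift, `φ` and quotient map.
  have h1 := (E'.contMDiff_mkTotal.comp hφ).contMDiffAt.comp z₀ (E.contMDiffAt_lift z₀)
  refine h1.congr_of_eventuallyEq ?_
  have hU : ∀ᶠ z : TotalSpace F E.Fiber in 𝓝 z₀, z.1 ∈ (sectionAt B z₀.1).U :=
    (contMDiffAt_proj E.Fiber (IB := 𝓘(ℝ, EM)) (n := ∞)).continuousAt.eventually
      ((sectionAt B z₀.1).isOpen_U.mem_nhds (mem_sectionAt z₀.1))
  filter_upwards [hU] with z hz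
  simp only [Function.comp_apply]
  rw [← h, E.mkTotal_lift hz]

/-- A map over `P` that covers a smooth map of the quotients is smooth. -/
theorem contMDiff_of_mkTotal_comp {Ψ : TotalSpace F E.Fiber → TotalSpace F' E'.Fiber}
    {φ : TotalSpace F V → TotalSpace F' V'}
    (hΨ : ContMDiff (𝓘(ℝ, EM).prod 𝓘(ℝ, F)) (𝓘(ℝ, EM).prod 𝓘(ℝ, F')) ∞ Ψ)
    (hbase : ∀ w, (φ w).1 = w.1) (h : ∀ w, Ψ (E.mkTotal w) = E'.mkTotal (φ w)) :
    ContMDiff (𝓘(ℝ, EP).prod 𝓘(ℝ, F)) (𝓘(ℝ, EP).prod 𝓘(ℝ, F')) ∞ φ := by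
  intro w₀
  have hΨE := hΨ.comp E.contMDiff_mkTotal
  set z₀ := Ψ (E.mkTotal w₀) with hz₀
  set σ := sectionAt B z₀.1 with hσ
  have hmem : z₀.1 ∈ σ.U := mem_sectionAt z₀.1
  have hbase' (w : TotalSpace F V) : (Ψ (E.mkTotal w)).1 = B.proj w.1 := by
    rw [h w]; exact congrArg B.proj (hbase w)
  have hU : ∀ᶠ w : TotalSpace F V in 𝓝 w₀, (Ψ (E.mkTotal w)).1 ∈ σ.U :=
    ((Bundle.contMDiff_proj E'.Fiber (IB := 𝓘(ℝ, EM)) (n := ∞)).comp hΨE).continuous.continuousAt.eventually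
      (σ.isOpen_U.mem_nhds hmem)
  have hl : ContMDiffAt (𝓘(ℝ, EP).prod 𝓘(ℝ, F)) (𝓘(ℝ, EP).prod 𝓘(ℝ, F')) ∞
      (fun w ↦ E'.lift σ (Ψ (E.mkTotal w))) w₀ :=
    ContMDiffAt.comp w₀ (g := E'.lift σ) (E'.contMDiffAt_lift z₀) (hΨE w₀)
  have hdiv : ContMDiffAt (𝓘(ℝ, EP).prod 𝓘(ℝ, F)) 𝓘(ℝ, EH) ∞
      (fun w : TotalSpace F V ↦ B.div (E'.lift σ (Ψ (E.mkTotal w))).1 w.1) w₀ := by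
    have h1 : ContMDiffWithinAt (𝓘(ℝ, EP).prod 𝓘(ℝ, F)) 𝓘(ℝ, EH) ∞
      (fun w : TotalSpace F V ↦ B.div (E'.lift σ (Ψ (E.mkTotal w))).1 w.1)
      {w | (Ψ (E.mkTotal w)).1 ∈ σ.U} w₀ :=
      ContMDiffWithinAt.comp w₀ (g := fun q : P × P ↦ B.div q.1 q.2)
        (f := fun w : TotalSpace F V ↦ ((E'.lift σ (Ψ (E.mkTotal w))).1, w.1))
        (B.contMDiffOn_div_fiberProduct _ ((σ.proj_s _ hmem).trans (hbase' _)))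
        ((((Bundle.contMDiff_proj V') _).comp w₀ hl).prodMk ((Bundle.contMDiff_proj V) w₀)).contMDiffWithinAt
        (fun w hw ↦ (σ.proj_s _ hw).trans (hbase' _))
    exact h1.contMDiffAt hU
  -- The lift of `Ψ [w]` lies over the section; translating it back to the base point `w.1` yields
  -- `φ w`.
  have hact : ContMDiffAt (𝓘(ℝ, EP).prod 𝓘(ℝ, F)) (𝓘(ℝ, EP).prod 𝓘(ℝ, F')) ∞
      (fun w : TotalSpace F V ↦ E'.act (E'.lift σ (Ψ (E.mkTotal w)))
        (B.div (E'.lift σ (Ψ (E.mkTotal w))).1 w.1)) w₀ :=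
    ContMDiffAt.comp w₀ (E'.smooth (_, _)) (hl.prodMk hdiv)
  refine hact.congr_of_eventuallyEq (hU.mono fun w hw ↦ ?_)
  have := act_div_of_mkTotal_eq ((E'.mkTotal_lift hw).trans (h w))
  -- The translating element now involves `w.1` and not `φ w`, whose smoothness is the claim.
  rw [hbase] at this
  exact this.symm

end EquivariantBundle

end Quotient

end PrincipalBundle

/-! ### Smoothness of the inverse of a bundle isomorphism. -/

section BundleEquiv

variable {EM M : Type*} [NormedAddCommGroup EM] [NormedSpace ℝ EM]
  [TopologicalSpace M] [ChartedSpace EM M]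
  {F₁ F₂ : Type*} [NormedAddCommGroup F₁] [NormedSpace ℝ F₁] [FiniteDimensional ℝ F₁]
  [NormedAddCommGroup F₂] [NormedSpace ℝ F₂]

/-- A map into the continuous linear maps from a finite-dimensional space is smooth if its values
at all vectors are. -/
theorem contMDiffAt_clm_of_forall_apply {f : M → F₁ →L[ℝ] F₂} {x₀ : M}
    (h : ∀ y, ContMDiffAt 𝓘(ℝ, EM) 𝓘(ℝ, F₂) ∞ (fun x ↦ f x y) x₀) :
    ContMDiffAt 𝓘(ℝ, EM) 𝓘(ℝ, F₁ →L[ℝ] F₂) ∞ f x₀ := by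
  -- Coordinates on `F₁`; through `e₂` a linear map becomes the tuple of its values on a basis.
  let e₁ := ContinuousLinearEquiv.ofFinrankEq (𝕜 := ℝ) (E := F₁)
    (F := Fin (Module.finrank ℝ F₁) → ℝ) (by simp)
  let e₂ := (e₁.arrowCongr (1 : F₂ ≃L[ℝ] F₂)).trans
    (ContinuousLinearEquiv.piRing (Fin (Module.finrank ℝ F₁)))
  have h2 : ContMDiffAt 𝓘(ℝ, EM) 𝓘(ℝ, Fin (Module.finrank ℝ F₁) → F₂) ∞
      (fun x ↦ e₂ (f x)) x₀ := contMDiffAt_pi_space.2 fun i ↦ h _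
  refine ((e₂.symm.contDiff.contMDiff _).comp x₀ h2).congr_of_eventuallyEq
    (Filter.Eventually.of_forall fun x ↦ ?_)
  exact (e₂.symm_apply_apply (f x)).symm

variable {E₁ : M → Type*} [TopologicalSpace (TotalSpace F₁ E₁)] [∀ x, AddCommGroup (E₁ x)]
  [∀ x, Module ℝ (E₁ x)] [∀ x, TopologicalSpace (E₁ x)] [FiberBundle F₁ E₁]
  [VectorBundle ℝ F₁ E₁] [ContMDiffVectorBundle ∞ F₁ E₁ 𝓘(ℝ, EM)]
  {E₂ : M → Type*} [TopologicalSpace (TotalSpace F₂ E₂)] [∀ x, AddCommGroup (E₂ x)]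
  [∀ x, Module ℝ (E₂ x)] [∀ x, TopologicalSpace (E₂ x)] [FiberBundle F₂ E₂]
  [VectorBundle ℝ F₂ E₂] [ContMDiffVectorBundle ∞ F₂ E₂ 𝓘(ℝ, EM)]

/-- The inverse of a smooth, fibrewise linear and bijective map of vector bundles is smooth. -/
theorem contMDiff_bundleEquiv_symm (e : ∀ x, E₁ x ≃ₗ[ℝ] E₂ x)
    (h : ContMDiff (𝓘(ℝ, EM).prod 𝓘(ℝ, F₁)) (𝓘(ℝ, EM).prod 𝓘(ℝ, F₂)) ∞
      (fun z : TotalSpace F₁ E₁ ↦ (⟨z.1, e z.1 z.2⟩ : TotalSpace F₂ E₂))) :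
    ContMDiff (𝓘(ℝ, EM).prod 𝓘(ℝ, F₂)) (𝓘(ℝ, EM).prod 𝓘(ℝ, F₁)) ∞
      (fun z : TotalSpace F₂ E₂ ↦ (⟨z.1, (e z.1).symm z.2⟩ : TotalSpace F₁ E₁)) := by
  intro z₀
  have hproj : ContMDiffAt (𝓘(ℝ, EM).prod 𝓘(ℝ, F₂)) 𝓘(ℝ, EM) ∞
    (fun z : TotalSpace F₂ E₂ ↦ z.1) z₀ := Bundle.contMDiffAt_proj E₂
  rw [contMDiffAt_totalSpace]
  refine ⟨hproj, ?_⟩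
  obtain ⟨x₀, v₀⟩ := z₀
  change ContMDiffAt _ _ _ (fun z : TotalSpace F₂ E₂ ↦
    (trivializationAt F₁ E₁ x₀ ⟨z.1, (e z.1).symm z.2⟩).2) _
  set t₁ := trivializationAt F₁ E₁ x₀
  set t₂ := trivializationAt F₂ E₂ x₀
  have hx₁ : x₀ ∈ t₁.baseSet := mem_baseSet_trivializationAt F₁ E₁ x₀
  have hx₂ : x₀ ∈ t₂.baseSet := mem_baseSet_trivializationAt F₂ E₂ x₀
  have hS : ∀ᶠ x in 𝓝 x₀, x ∈ t₁.baseSet ∩ t₂.baseSet :=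
    (t₁.open_baseSet.inter t₂.open_baseSet).mem_nhds ⟨hx₁, hx₂⟩
  -- The local matrix of `e`. In coordinates the inverse bundle map is `(x, y) ↦ (x, A(x)⁻¹ y)`.
  let A : M → F₁ →L[ℝ] F₂ := fun x ↦ LinearMap.toContinuousLinearMap
    (t₂.linearMapAt ℝ x ∘ₗ (e x).toLinearMap ∘ₗ t₁.symmₗ ℝ x)
  have hA : ContMDiffAt 𝓘(ℝ, EM) 𝓘(ℝ, F₁ →L[ℝ] F₂) ∞ A x₀ := by
    refine contMDiffAt_clm_of_forall_apply fun y ↦ ?_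
    have s1 : ContMDiffAt 𝓘(ℝ, EM) (𝓘(ℝ, EM).prod 𝓘(ℝ, F₁)) ∞
        (fun x ↦ t₁.toOpenPartialHomeomorph.symm (x, y)) x₀ := by
      refine ContMDiffAt.comp x₀ (t₁.contMDiffOn_symm.contMDiffAt ?_)
        (contMDiffAt_id.prodMk contMDiffAt_const)
      exact t₁.open_target.mem_nhds (t₁.mem_target.2 hx₁)
    have s2 := (h _).comp x₀ s1
    have s3 := ((t₂.contMDiffAt_iff (IB := 𝓘(ℝ, EM)) (by
      rw [t₂.mem_source]
      change (t₁.toOpenPartialHomeomorph.symm (x₀, y)).1 ∈ _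
      rw [← t₁.mk_symm hx₁]
      exact hx₂)).1 s2).2
    refine s3.congr_of_eventuallyEq (hS.mono fun x hx ↦ ?_)
    simp only [A, Function.comp_apply, LinearMap.coe_toContinuousLinearMap', LinearMap.comp_apply]
    rw [← t₁.mk_symm hx.1, t₁.symmₗ_apply (R := ℝ) hx.1, t₂.coe_linearMapAt_of_mem (R := ℝ) hx.2]
    rfl
  have hinv (x : M) (hx : x ∈ t₁.baseSet ∩ t₂.baseSet) : A x =
      (((t₁.linearEquivAt ℝ x hx.1).symm.trans ((e x).trans
        (t₂.linearEquivAt ℝ x hx.2))).toContinuousLinearEquiv : F₁ →L[ℝ] F₂) := by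
    ext y
    simp only [A, LinearMap.coe_toContinuousLinearMap', LinearMap.comp_apply]
    rw [t₁.symmₗ_apply (R := ℝ) hx.1, t₂.coe_linearMapAt_of_mem (R := ℝ) hx.2]
    rfl
  -- `ContinuousLinearMap.inverse` is a total function, smooth at invertible maps; `hinv` shows that
  -- `A` is invertible near `x₀`.
  have hAi : ContMDiffAt 𝓘(ℝ, EM) 𝓘(ℝ, F₂ →L[ℝ] F₁) ∞
      (fun x ↦ ContinuousLinearMap.inverse (A x)) x₀ := by
    have : CompleteSpace F₁ := FiniteDimensional.complete ℝ F₁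
    refine ContMDiffAt.comp x₀ (g := ContinuousLinearMap.inverse) ?_ hA
    rw [hinv x₀ ⟨hx₁, hx₂⟩]
    exact (contDiffAt_map_inverse _).contMDiffAt
  have hz := (contMDiffAt_totalSpace.1 (contMDiffAt_id (I := 𝓘(ℝ, EM).prod 𝓘(ℝ, F₂))
    (n := ∞) (x := (⟨x₀, v₀⟩ : TotalSpace F₂ E₂)))).2
  have hfin := (ContMDiffAt.comp (⟨x₀, v₀⟩ : TotalSpace F₂ E₂) hAi hproj).clm_apply hz
  refine hfin.congr_of_eventuallyEq ((hproj.continuousAt.eventually hS).mono fun z hz ↦ ?_)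
  simp only [Function.comp_apply]
  rw [hinv z.1 hz, ContinuousLinearMap.inverse_equiv]
  change _ = t₁.linearEquivAt ℝ z.1 hz.1 ((e z.1).symm ((t₂.linearEquivAt ℝ z.1 hz.2).symm _))
  have : (t₂ z).2 = t₂.linearEquivAt ℝ z.1 hz.2 z.2 := rfl
  erw [this, LinearEquiv.symm_apply_apply]
  rfl

end BundleEquiv

/-! ### The dimension of `P`. -/

namespace PrincipalBundle

variable {EH EP EM H P M : Type*}
  [NormedAddCommGroup EH] [NormedSpace ℝ EH] [NormedAddCommGroup EP] [NormedSpace ℝ EP]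
  [NormedAddCommGroup EM] [NormedSpace ℝ EM]
  [TopologicalSpace H] [ChartedSpace EH H] [Group H]
  [TopologicalSpace P] [ChartedSpace EP P] [TopologicalSpace M] [ChartedSpace EM M]

/-- The dimension of the total space of a principal bundle. -/
theorem finrank_totalSpace [FiniteDimensional ℝ EH] [FiniteDimensional ℝ EM]
    (B : PrincipalBundle EH EP EM H P M) (p : P) :
    Module.finrank ℝ EP = Module.finrank ℝ EM + Module.finrank ℝ EH := by
  obtain ⟨U, e, hU, hx, hs, ht, h1, h2, h3, h4⟩ := B.locally_trivial (B.proj p)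
  have hp : p ∈ e.source := by rw [hs]; exact hx
  have he : e.MDifferentiable 𝓘(ℝ, EP) (𝓘(ℝ, EM).prod 𝓘(ℝ, EH)) :=
    ⟨h3.mdifferentiableOn (by simp), h4.mdifferentiableOn (by simp)⟩
  -- A trivialization is a diffeomorphism, so its differential at `p` is invertible.
  have L : EP ≃ₗ[ℝ] EM × EH := (he.mfderiv hp).toLinearEquiv
  rw [L.finrank_eq, Module.finrank_prod]

end PrincipalBundle

/-! ### Cartan geometries and isomorphisms `TP/H → P ×_H 𝔤`. -/

namespace PrincipalBundle

variable {EH EP EM H P M 𝔤 : Type*}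
  [NormedAddCommGroup EH] [NormedSpace ℝ EH] [CompleteSpace EH]
  [NormedAddCommGroup EP] [NormedSpace ℝ EP]
  [NormedAddCommGroup EM] [NormedSpace ℝ EM]
  [TopologicalSpace H] [ChartedSpace EH H] [Group H] [LieGroup 𝓘(ℝ, EH) ∞ H]
  [TopologicalSpace P] [ChartedSpace EP P] [IsManifold 𝓘(ℝ, EP) ∞ P]
  [TopologicalSpace M] [ChartedSpace EM M]
  [NormedLieRing 𝔤] [NormedLieAlgebra 𝔤]
  {B : PrincipalBundle EH EP EM H P M} {m : CartanModel EH H 𝔤}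

/-- A `𝔤`-valued function on `TP` is smooth if and only if the corresponding map from `TP` to the
product bundle `P × 𝔤` is. -/
theorem contMDiff_toTrivial_iff {f : ∀ p : P, TangentSpace 𝓘(ℝ, EP) p → 𝔤} :
    ContMDiff (𝓘(ℝ, EP).prod 𝓘(ℝ, EP)) (𝓘(ℝ, EP).prod 𝓘(ℝ, 𝔤)) ∞
      (fun w : TangentBundle 𝓘(ℝ, EP) P ↦
        (⟨w.1, f w.1 w.2⟩ : TotalSpace 𝔤 (Bundle.Trivial P 𝔤))) ↔
    ContMDiff (𝓘(ℝ, EP).prod 𝓘(ℝ, EP)) 𝓘(ℝ, 𝔤) ∞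
      (fun w : TangentBundle 𝓘(ℝ, EP) P ↦ f w.1 w.2) := by
  refine ⟨fun h w ↦ ?_, fun h w ↦ ?_⟩
  · exact (contMDiffAt_totalSpace.1 (h w)).2
  · rw [contMDiffAt_totalSpace]
    exact ⟨Bundle.contMDiff_proj _ w, h w⟩

namespace CartanGeometry

theorem form_injective : Function.Injective (form : B.CartanGeometry m → _) := by
  rintro ⟨⟩ ⟨⟩ h
  congr

variable (θ : B.CartanGeometry m)

/-- The linear isomorphism of the fibres over `x` of the Atiyah bundle and of the adjoint tractor
bundle that is defined by a Cartan geometry. -/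
noncomputable def fiberEquiv (x : M) : B.Atiyah x ≃ₗ[ℝ] B.Tractor m x :=
  (B.tangent.clsₗ _ (B.exists_proj_eq x).choose_spec).symm.trans
    ((LinearEquiv.ofBijective (θ.form _) (θ.bijective _)).trans
      ((B.associated m.ad).clsₗ _ (B.exists_proj_eq x).choose_spec))

/-- Equivariance of the form makes the point chosen in `fiberEquiv` immaterial. -/
theorem fiberEquiv_cls {x : M} (p : P) (hp : B.proj p = x) (v : TangentSpace 𝓘(ℝ, EP) p) :
    θ.fiberEquiv x (B.tangent.cls p hp v) = (B.associated m.ad).cls p hp (θ.form p v) := by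
  -- The chosen point is generalized to a variable `q`, for which `p a` can be substituted.
  have key : ∀ (q : P) (hq : B.proj q = x), (B.associated m.ad).cls q hq
      (θ.form q ((B.tangent.clsₗ q hq).symm (B.tangent.cls p hp v))) =
      (B.associated m.ad).cls p hp (θ.form p v) := by
    intro q hq
    obtain ⟨a, rfl⟩ := B.exists_act_eq (hp.trans hq.symm)
    have h1 : B.tangent.cls p hp v = B.tangent.clsₗ (B.act p a) hq (B.dact p a v) :=
      (EquivariantBundle.cls_map (E := B.tangent) p hp a v).symm
    rw [h1, LinearEquiv.symm_apply_apply, θ.equivariant]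
    exact EquivariantBundle.cls_map (E := B.associated m.ad) p hp a (θ.form p v)
  exact key _ (B.exists_proj_eq x).choose_spec

variable [FiniteDimensional ℝ EP] [FiniteDimensional ℝ 𝔤]

/-- The isomorphism of the Atiyah bundle with the adjoint tractor bundle defined by a Cartan
geometry. -/
noncomputable def toIso : B.AtiyahTractorIso m :=
  have h : ContMDiff (𝓘(ℝ, EM).prod 𝓘(ℝ, EP)) (𝓘(ℝ, EM).prod 𝓘(ℝ, 𝔤)) ∞
      (fun z : TotalSpace EP B.Atiyah ↦
        (⟨z.1, θ.fiberEquiv z.1 z.2⟩ : TotalSpace 𝔤 (B.Tractor m))) :=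
    EquivariantBundle.contMDiff_of_mkTotal (E := B.tangent) (E' := B.associated m.ad)
      (φ := fun w ↦ ⟨w.1, θ.form w.1 w.2⟩)
      ((contMDiff_toTrivial_iff (f := fun p v ↦ θ.form p v)).2 θ.smooth)
      fun w ↦ TotalSpace.ext rfl (heq_of_eq (θ.fiberEquiv_cls w.1 rfl w.2))
  { equiv := θ.fiberEquiv
    smooth := h
    smooth_symm := contMDiff_bundleEquiv_symm θ.fiberEquiv h
    reduces_to_id := by
      intro x s
      -- On a class `[p, ξ]` the claim is `ω(ξ̃) = ξ`.
      obtain ⟨⟨⟨p, ξ⟩, hp⟩, rfl⟩ := Quotient.exists_rep s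
      exact (θ.fiberEquiv_cls p hp _).trans
        (congrArg ((B.associated m.ad).cls p hp) (θ.form_fundamental p ξ)) }

end CartanGeometry

namespace AtiyahTractorIso

variable [FiniteDimensional ℝ EP] [FiniteDimensional ℝ 𝔤]

theorem equiv_injective :
    Function.Injective fun Ψ : B.AtiyahTractorIso m ↦ Ψ.toVectorBundleIso.equiv := by
  rintro ⟨⟨e, _, _⟩, _⟩ ⟨⟨e', _, _⟩, _⟩ h
  obtain rfl : e = e' := h
  rfl

variable (Ψ : B.AtiyahTractorIso m)

/-- The `𝔤`-valued 1-form on `P` defined by an isomorphism of the Atiyah bundle with the adjoint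
tractor bundle. -/
noncomputable def form (p : P) : TangentSpace 𝓘(ℝ, EP) p ≃ₗ[ℝ] 𝔤 :=
  (B.tangent.clsₗ p rfl).trans
    ((Ψ.equiv (B.proj p)).trans ((B.associated m.ad).clsₗ p rfl).symm)

/-- The free `x` lets the forms at `p` and `p a` be compared in one fibre, although `B.proj (B.act p
a)` and `B.proj p` are only propositionally equal. -/
theorem cls_form {x : M} (p : P) (hp : B.proj p = x) (v : TangentSpace 𝓘(ℝ, EP) p) :
    (B.associated m.ad).cls p hp (Ψ.form p v) = Ψ.equiv x (B.tangent.cls p hp v) := by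
  subst hp
  exact ((B.associated m.ad).clsₗ p rfl).apply_symm_apply _

/-- The Cartan geometry defined by an isomorphism of the Atiyah bundle with the adjoint tractor
bundle. -/
noncomputable def toCartanGeometry : B.CartanGeometry m where
  form p := (Ψ.form p).toLinearMap
  smooth := (contMDiff_toTrivial_iff (f := fun p v ↦ Ψ.form p v)).1 <|
    EquivariantBundle.contMDiff_of_mkTotal_comp (E := B.tangent) (E' := B.associated m.ad)
      (φ := fun w ↦ ⟨w.1, Ψ.form w.1 w.2⟩) Ψ.smooth (fun _ ↦ rfl)
      fun w ↦ TotalSpace.ext rfl (heq_of_eq (Ψ.cls_form w.1 rfl w.2).symm)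
  bijective p := (Ψ.form p).bijective
  equivariant p a v := by
    have hpa : B.proj (B.act p a) = B.proj p := B.proj_act p a
    -- The class map at `p a` is injective, and it sends both sides to the image of `[v]` under `Ψ`.
    refine ((B.associated m.ad).clsₗ (B.act p a) hpa).injective ?_
    refine (Ψ.cls_form _ hpa _).trans (Eq.trans ?_
      (EquivariantBundle.cls_map (E := B.associated m.ad) p rfl a (Ψ.form p v)).symm)
    rw [Ψ.cls_form]
    exact congrArg _ (EquivariantBundle.cls_map (E := B.tangent) p rfl a v)
  form_fundamental p ξ := by
    refine ((B.associated m.ad).clsₗ p rfl).injective ((Ψ.cls_form p rfl _).trans ?_)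
    exact Ψ.reduces_to_id _ ((B.associated (adjointRep EH H)).cls p rfl ξ)

end AtiyahTractorIso

variable [FiniteDimensional ℝ EP] [FiniteDimensional ℝ 𝔤]

/-- The correspondence of Cartan geometries with the isomorphisms of the Atiyah bundle with the
adjoint tractor bundle that reduce to the identity on the adjoint bundle. -/
noncomputable def cartanGeometryEquiv : B.CartanGeometry m ≃ B.AtiyahTractorIso m where
  toFun θ := θ.toIso
  invFun Ψ := Ψ.toCartanGeometry
  left_inv θ := by
    refine CartanGeometry.form_injective (funext fun p ↦ LinearMap.ext fun v ↦ ?_)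
    exact ((B.associated m.ad).clsₗ p rfl).injective
      ((θ.toIso.cls_form p rfl v).trans (θ.fiberEquiv_cls p rfl v))
  right_inv Ψ := by
    refine AtiyahTractorIso.equiv_injective (funext fun x ↦ LinearEquiv.ext fun z ↦ ?_)
    -- Represented at the very point used by `fiberEquiv`, each class reduces the claim to the two
    -- formulas for the class of the form.
    obtain ⟨v, rfl⟩ := (B.tangent.clsₗ _ (B.exists_proj_eq x).choose_spec).surjective z
    exact (Ψ.toCartanGeometry.fiberEquiv_cls _ _ v).trans (Ψ.cls_form _ _ v)

end PrincipalBundle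

theorem theorem1 {EH EP EM H P M 𝔤 : Type*}
    [NormedAddCommGroup EH] [NormedSpace ℝ EH] [FiniteDimensional ℝ EH] [CompleteSpace EH]
    [NormedAddCommGroup EP] [NormedSpace ℝ EP] [FiniteDimensional ℝ EP]
    [NormedAddCommGroup EM] [NormedSpace ℝ EM] [FiniteDimensional ℝ EM]
    [TopologicalSpace H] [ChartedSpace EH H] [Group H] [LieGroup 𝓘(ℝ, EH) ∞ H]
    [TopologicalSpace P] [ChartedSpace EP P] [IsManifold 𝓘(ℝ, EP) ∞ P]
    [TopologicalSpace M] [ChartedSpace EM M] [IsManifold 𝓘(ℝ, EM) ∞ M]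
    [NormedLieRing 𝔤] [NormedLieAlgebra 𝔤] [FiniteDimensional ℝ 𝔤]
    (m : CartanModel EH H 𝔤) (B : PrincipalBundle EH EP EM H P M)
    (hdim : (Module.finrank ℝ EM : ℤ) = Module.finrank ℝ 𝔤 - Module.finrank ℝ m.𝔥) :
    (∀ x : M, Module.finrank ℝ (B.Atiyah x) = Module.finrank ℝ 𝔤 ∧
      Module.finrank ℝ (B.Tractor m x) = Module.finrank ℝ 𝔤) ∧
    ∃ Φ : B.CartanGeometry m ≃ B.AtiyahTractorIso m,
      ∀ (θ : B.CartanGeometry m) (x : M) (p : P) (hp : B.proj p = x)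
        (v : TangentSpace 𝓘(ℝ, EP) p),
        (Φ θ).equiv x (B.tangent.cls p hp v) = (B.associated m.ad).cls p hp (θ.form p v) := by
  -- The Lie algebra of `H` has `EH` as its underlying space, so the model fixes the dimension of
  -- `H`.
  have hH : Module.finrank ℝ EH = Module.finrank ℝ m.𝔥 := m.iso.toLinearEquiv.finrank_eq
  refine ⟨fun x ↦ ?_, PrincipalBundle.cartanGeometryEquiv,
    fun θ x p hp v ↦ θ.fiberEquiv_cls p hp v⟩
  obtain ⟨p, hp⟩ := B.exists_proj_eq x
  have hT : Module.finrank ℝ EP = Module.finrank ℝ (B.Atiyah x) :=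
    (B.tangent.clsₗ p hp).finrank_eq
  have hW : Module.finrank ℝ 𝔤 = Module.finrank ℝ (B.Tractor m x) :=
    ((B.associated m.ad).clsₗ p hp).finrank_eq
  -- With `hH` and `hdim` this gives `dim P = dim 𝔤`; the class maps at `p` carry it to both fibres.
  have hP := B.finrank_totalSpace p
  constructor <;> omega
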